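/- **Quivers and DT invariants.** A symmetric quiver $Q=(C,\boldsymbol x)$ consists of a set of nodes, a symmetric integer matrix $C$ indexed by the nodes, and a generating parameter for each node, namely a monomial in formal variables times a power of $q$. A dimension vector $\boldsymbol d$ assigns a non-negative integer to each node, with only finitely many of them non-zero. If each monomial in the formal variables arises from finitely many dimension vectors, the motivic generating series is $$P_Q(\boldsymbol x,q)=\sum_{\boldsymbol d}(-q)^{\boldsymbol d\cdot C\cdot\boldsymbol d}\prod_i\frac{x_i^{d_i}}{(q^2;q^2)_{d_i}},\qquad (q^2;q^2)_n=\prod_{k=1}^{n}(1-q^{2k}),$$ a formal power series in the formal variables with coefficients in $\mathbb Z((q))$. The motivic DT invariants (the BPS spectrum) of $Q$ are the integers $\Omega_{\boldsymbol e,s}$, indexed by the exponents $\boldsymbol e\neq 0$ of monomials $\boldsymbol x^{\boldsymbol e}$ in the formal variables and by $s\in\mathbb Z$, and vanishing for each $\boldsymbol e$ when $s$ is sufficiently negative, such that $$P_Q(\boldsymbol x,q)=\prod_{\boldsymbol e\ne0}\prod_{s\in\mathbb Z}\prod_{k\ge0}\bigl(1-\boldsymbol x^{\boldsymbol e}q^{2k+s}\bigr)^{\Omega_{\boldsymbol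 e,s}}.$$ **Splitting.** Let $n$ nodes of $Q$ be labelled $1,\dots,n$, let $\sigma\in S_n$, let $h_s\in\mathbb Z$ for each other node $s$ (a spectator), and let $\kappa$ be a monomial. The $(k,l)$-splitting of $Q$ keeps all nodes of $Q$ with their parameters and the arrows between them, and adds for each split node $i$ a new node $i'$ with parameter $x_i\kappa$ and with $$C_{s i'}=C_{si}+h_s,\qquad C_{ii'}=C_{ii}+k,\qquad C_{i'j'}=C_{ij}+l\ \text{ for all split nodes } i,j,$$ $$C_{ij'}=C_{ij}+k\ \text{ if }\sigma(i)<\sigma(j),\qquad C_{ij'}=C_{ij}+k+1\ \text{ if }\sigma(i)>\sigma(j)\qquad(i\ne j).$$ Quivers $Q_1\subset Q_2\subset\cdots$ grow by $(k,l)$-splitting of $n$ nodes if $Q_2$ is a $(k,l)$-splitting of $n$ nodes of $Q_1$, and each $Q_{i+1}$ with $i\geq 2$ is the $(k,l)$-splitting of the $n$ nodes of $Q_i$ created in the previous step, with the same factor $\kappa$ in all steps and with permutations that may depend on the step. Put $Q_\infty=\bigcup_i Q_i$. **Theorem.** Let $Q_1$ be a finite symmetric quiver whose generating parameters are independent variables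 $x_v$, one for each node $v$, and let $x_0$ be one more variable. Let $Q_1\subset Q_2\subset\cdots$ grow by $(k,l)$-splitting of $n$ nodes, with all spectator shifts equal to $0$ in every step, where either 1. $(k,l)=(0,2)$ and $\kappa=q^{-1}x_0$; let $Q_1^+$ be $Q_1$ with an extra node that has parameter $x_0$, one loop, matrix entry $1$ with each of the $n$ nodes of $Q_1$ that are split, and matrix entry $0$ with all other nodes; or 2. $(k,l)=(-1,-2)$ and $\kappa=x_0$; let $Q_1^+$ be $Q_1$ with an extra node that has parameter $x_0$, no loops, matrix entry $-1$ with each of the $n$ nodes of $Q_1$ that are split, and matrix entry $0$ with all other nodes. Then the generating series of $Q_\infty$ is well defined, the motivic DT invariants of $Q_\infty$, of $Q_1^+$ and of the extra node alone exist and are unique, and the BPS spectrum of $Q_\infty$ is that of $Q_1^+$ minus the single state coming from the extra node: if $\boldsymbol e_0$ denotes the exponent of the monomial $x_0$, then the extra node alone has exactly one non-zero DT invariant, $\Omega_{\boldsymbol e_0,1}=1$ in case 1 and $\Omega_{\boldsymbol e_0,0}=-1$ in case 2, and $$\Omega^{Q_\infty}_{\boldsymbol e,s}=\Omega^{Q_1^+}_{\boldsymbol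 e,s}-\Omega^{\text{extra node}}_{\boldsymbol e,s}\quad\text{for all }\boldsymbol e\neq 0,\ s\in\mathbb Z,\qquad \Omega^{Q_\infty}_{\boldsymbol e_0,s}=0\quad\text{for all }s\in\mathbb Z.$$ -/

import Mathlib

open Filter

/-- A symmetric quiver with (possibly infinite) node set `ι`: a symmetric integer adjacency matrix
`C` together with a generating parameter at each node. The generating parameters are monomials in
`q` and the formal variables `x_t`, `t : τ`; the pair `(a, w)` stands for `q ^ a * ∏ t, x_t ^ w t`,
so that a product of such monomials is the sum of the corresponding pairs. -/
structure SymQuiver (ι τ : Type*) where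
  C : ι → ι → ℤ
  symm : ∀ i j, C i j = C j i
  param : ι → ℤ × (τ →₀ ℕ)

/-! ### The motivic generating series and the motivic DT invariants -/

/-- The monomial `q ^ a` in `ℤ((q))`. -/
noncomputable def qPow (a : ℤ) : LaurentSeries ℤ := HahnSeries.single a 1

/-- The monomial `(-q) ^ a` in `ℤ((q))`. -/
noncomputable def negQPow (a : ℤ) : LaurentSeries ℤ :=
  HahnSeries.single a ((a.negOnePow : ℤˣ) : ℤ)

/-- The `q`-Pochhammer symbol `(q²; q²)_n = ∏_{k < n} (1 - q² q^{2k})` in `ℤ((q))`. -/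
noncomputable def qPoch (n : ℕ) : LaurentSeries ℤ :=
  ∏ k ∈ Finset.range n, (1 - qPow 2 * qPow (2 * (k : ℤ)))

theorem isUnit_qPoch (n : ℕ) : IsUnit (qPoch n) := by
  refine Submonoid.prod_mem (IsUnit.submonoid _) fun k _ => ?_
  refine HahnSeries.isUnit_of_orderTop_pos ?_
  have h : (1 - qPow 2 * qPow (2 * (k : ℤ)) - 1 : LaurentSeries ℤ)
      = -HahnSeries.single (2 + 2 * (k : ℤ)) 1 := by
    simp [qPow, HahnSeries.single_mul_single]
  rw [h, HahnSeries.orderTop_neg, HahnSeries.orderTop_single one_ne_zero]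
  exact_mod_cast (by positivity : (0 : ℤ) < 2 + 2 * (k : ℤ))

namespace SymQuiver

variable {ι τ : Type*}

/-- The quadratic form `d · C · d` at a finitely supported dimension vector `d`. -/
def quadForm (Q : SymQuiver ι τ) (d : ι →₀ ℕ) : ℤ :=
  d.sum fun i a => d.sum fun j b => Q.C i j * (a : ℤ) * (b : ℤ)

/-- The monomial `∏ i, (x_i) ^ (d i)` in the generating parameters `x_i` of `Q`, as a pair. -/
noncomputable def monomial (Q : SymQuiver ι τ) (d : ι →₀ ℕ) : ℤ × (τ →₀ ℕ) :=
  d.sum fun i a => a • Q.param i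

/-- The coefficient in `ℤ((q))` contributed by the dimension vector `d` to the generating series:
`(-q) ^ (d · C · d)`, times the power of `q` contained in the generating parameters, divided by
`∏ i, (q²; q²)_{d i}` (a unit of `ℤ((q))`). -/
noncomputable def term (Q : SymQuiver ι τ) (d : ι →₀ ℕ) : LaurentSeries ℤ :=
  negQPow (Q.quadForm d) * qPow (Q.monomial d).1 * d.prod fun _ a => Ring.inverse (qPoch a)

/-- The dimension vectors that contribute to the monomial `x ^ e` of the generating series. -/
def dimVectors (Q : SymQuiver ι τ) (e : τ →₀ ℕ) : Set (ι →₀ ℕ) :=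
  {d | (Q.monomial d).2 = e}

/-- Each monomial `x ^ e` receives contributions from finitely many dimension vectors, so that the
generating series is a well-defined formal power series (also for infinitely many nodes). -/
def IsLocallyFinite (Q : SymQuiver ι τ) : Prop := ∀ e, (Q.dimVectors e).Finite

/-- The motivic generating series
`P_Q(x, q) = ∑_d (-q) ^ (d · C · d) ∏ i, x_i ^ (d i) / (q²; q²)_{d i}`
as a formal power series in the variables `x_t` with coefficients in `ℤ((q))`. -/
noncomputable def motivicSeries (Q : SymQuiver ι τ) : MvPowerSeries τ (LaurentSeries ℤ) :=
  fun e => ∑ᶠ d ∈ Q.dimVectors e, Q.term d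

end SymQuiver

theorem constantCoeff_dilog {τ : Type*} (d : {d : τ →₀ ℕ // d ≠ 0}) (a : ℤ) :
    MvPowerSeries.constantCoeff (1 - MvPowerSeries.monomial d.1 (qPow a))
      = ((1 : (LaurentSeries ℤ)ˣ) : LaurentSeries ℤ) := by
  classical
  rw [map_sub, map_one, ← MvPowerSeries.coeff_zero_eq_constantCoeff_apply,
    MvPowerSeries.coeff_monomial, if_neg d.2.symm, sub_zero, Units.val_one]

/-- The factor `1 - x ^ d * q ^ a`, `d ≠ 0`, of a quantum dilogarithm, as an invertible formal
power series. -/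
noncomputable def dilogFactor {τ : Type*} (d : {d : τ →₀ ℕ // d ≠ 0}) (a : ℤ) :
    (MvPowerSeries τ (LaurentSeries ℤ))ˣ where
  val := 1 - MvPowerSeries.monomial d.1 (qPow a)
  inv := MvPowerSeries.invOfUnit (1 - MvPowerSeries.monomial d.1 (qPow a)) 1
  val_inv := MvPowerSeries.mul_invOfUnit _ _ (constantCoeff_dilog d a)
  inv_val := MvPowerSeries.invOfUnit_mul _ _ (constantCoeff_dilog d a)

/-- `Ω` is the family of motivic DT invariants of `Q`. Here `Ω d = ∑ s, Ω_{d,s} q ^ s` with integers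
`Ω_{d,s} = (Ω d).coeff s` that vanish for `s` very negative, and the invariants are determined by
`P_Q(x, q) = ∏_{d ≠ 0} ∏_{s ∈ ℤ} ∏_{k ≥ 0} (1 - x ^ d q ^ (2 k + s)) ^ Ω_{d,s}`.
The infinite product is formal: the coefficient of each `x ^ e q ^ t` in the finite partial products
is eventually equal to the one in `P_Q`. -/
def IsDTInvariants {ι τ : Type*} (Q : SymQuiver ι τ)
    (Ω : {d : τ →₀ ℕ // d ≠ 0} → LaurentSeries ℤ) : Prop :=
  Q.IsLocallyFinite ∧
  ∀ (e : τ →₀ ℕ) (t : ℤ), ∀ᶠ F : Finset ({d : τ →₀ ℕ // d ≠ 0} × ℤ × ℕ) in atTop,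
    (MvPowerSeries.coeff e
      ((∏ p ∈ F, dilogFactor p.1 (2 * (p.2.2 : ℤ) + p.2.1) ^ ((Ω p.1).coeff p.2.1) :
        (MvPowerSeries τ (LaurentSeries ℤ))ˣ) : MvPowerSeries τ (LaurentSeries ℤ))).coeff t
    = (MvPowerSeries.coeff e Q.motivicSeries).coeff t

/-! ### Splitting, growth by splitting, and the union of the growing quivers -/

/-- `Q'` is the `(k, l)`-splitting of the `n` nodes `sel 0, …, sel (n-1)` of `Q` with permutation `σ`,
spectator shifts `h` and multiplicative factor `κ`. The nodes of `Q'` are the nodes `old v` of `Q` and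
`n` created nodes; `new a` is the second copy of `sel a`. -/
structure IsSplitting {n : ℕ} {ι ι' τ : Type*} (k l : ℤ) (σ : Equiv.Perm (Fin n)) (h : ι → ℤ)
    (κ : ℤ × (τ →₀ ℕ)) (Q : SymQuiver ι τ) (Q' : SymQuiver ι' τ)
    (sel : Fin n ↪ ι) (old : ι ↪ ι') (new : Fin n ↪ ι') : Prop where
  nodes : IsCompl (Set.range old) (Set.range new)
  old_old : ∀ v w, Q'.C (old v) (old w) = Q.C v w
  spectator : ∀ s, s ∉ Set.range sel → ∀ a, Q'.C (old s) (new a) = Q.C s (sel a) + h s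
  old_new_self : ∀ a, Q'.C (old (sel a)) (new a) = Q.C (sel a) (sel a) + k
  old_new_of_lt : ∀ a b, σ a < σ b →
    Q'.C (old (sel a)) (new b) = Q.C (sel a) (sel b) + k
  old_new_of_gt : ∀ a b, σ b < σ a →
    Q'.C (old (sel a)) (new b) = Q.C (sel a) (sel b) + k + 1
  new_new : ∀ a b, Q'.C (new a) (new b) = Q.C (sel a) (sel b) + l
  param_old : ∀ v, Q'.param (old v) = Q.param v
  param_new : ∀ a, Q'.param (new a) = Q.param (sel a) + κ

/-- The quivers `Q 0, Q 1, Q 2, …` grow by `(k, l)`-splitting of `n` nodes with multiplicative factor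
`κ`: each `Q (i + 1)` is the `(k, l)`-splitting of the nodes `sel i` of `Q i`, and the nodes
`sel (i + 1)` that are split next are the ones created in this step. The permutations `perm i` and
the shifts `shift i` may vary with `i`. -/
structure SplittingGrowth (k l : ℤ) (n : ℕ) {τ : Type*} (κ : ℤ × (τ →₀ ℕ)) {V : ℕ → Type*}
    (Q : ∀ i, SymQuiver (V i) τ) where
  sel : ∀ i, Fin n ↪ V i
  incl : ∀ i, V i ↪ V (i + 1)
  perm : ∀ _ : ℕ, Equiv.Perm (Fin n)
  shift : ∀ i, V i → ℤ
  split : ∀ i, IsSplitting k l (perm i) (shift i) κ (Q i) (Q (i + 1)) (sel i) (incl i) (sel (i + 1))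

/-- The shifts of all spectators are zero in every step. -/
def SplittingGrowth.ShiftsZero {k l : ℤ} {n : ℕ} {τ : Type*} {κ : ℤ × (τ →₀ ℕ)} {V : ℕ → Type*}
    {Q : ∀ i, SymQuiver (V i) τ} (G : SplittingGrowth k l n κ Q) : Prop :=
  ∀ i s, s ∉ Set.range (G.sel i) → G.shift i s = 0

/-- `Qinf` is the union of the growing sequence `Q 0 ⊂ Q 1 ⊂ …`, where `Q i` is regarded as a full
subquiver of `Qinf` through `emb i`. -/
structure SplittingGrowth.IsUnion {k l : ℤ} {n : ℕ} {τ : Type*} {κ : ℤ × (τ →₀ ℕ)} {V : ℕ → Type*}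
    {Q : ∀ i, SymQuiver (V i) τ} (G : SplittingGrowth k l n κ Q) {W : Type*}
    (Qinf : SymQuiver W τ) (emb : ∀ i, V i ↪ W) : Prop where
  emb_incl : ∀ i v, emb (i + 1) (G.incl i v) = emb i v
  exhaust : ∀ w, ∃ i v, emb i v = w
  adj : ∀ i v w, Qinf.C (emb i v) (emb i w) = (Q i).C v w
  param : ∀ i v, Qinf.param (emb i v) = (Q i).param v

/-! ### The augmented quiver

The nodes of the initial quiver form a type `V`, and the formal variables are indexed by `Option V`:
`some v` is the variable `x_v` of the node `v`, and `none` is the variable `x_0` of the extra node. -/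

/-- The generating parameter of each node `v` is its own variable `x_v`. -/
def SymQuiver.HasFreeParams {V : Type*} (Q : SymQuiver V (Option V)) : Prop :=
  ∀ v, Q.param v = (0, Finsupp.single (some v) 1)

open Classical in
/-- The quiver `Q` together with an extra node (`none`) with generating parameter `x_0`, which
has `loops` loops, is joined to each of the nodes `sel a` by `arrows` pairs of arrows, and is not
joined to any other node. -/
noncomputable def SymQuiver.augment {V : Type*} {n : ℕ} (Q : SymQuiver V (Option V))
    (sel : Fin n ↪ V) (loops arrows : ℤ) : SymQuiver (Option V) (Option V) where
  C
    | none, none => loops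
    | none, some v => if v ∈ Set.range sel then arrows else 0
    | some v, none => if v ∈ Set.range sel then arrows else 0
    | some v, some w => Q.C v w
  symm i j := by
    cases i <;> cases j <;> first | rfl | exact Q.symm _ _
  param
    | none => (0, Finsupp.single none 1)
    | some v => Q.param v

/-- The full subquiver on the nodes in the range of `f`. -/
def SymQuiver.subquiver {ι κ τ : Type*} (Q : SymQuiver ι τ) (f : κ ↪ ι) : SymQuiver κ τ where
  C i j := Q.C (f i) (f j)
  symm i j := Q.symm (f i) (f j)
  param i := Q.param (f i)

/-- The dimension vector `e_0` of the extra node. -/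
noncomputable def extraDim (V : Type*) : {d : Option V →₀ ℕ // d ≠ 0} :=
  ⟨Finsupp.single none 1, by simp⟩

open Classical in
/-- The spectrum that consists of the single state `ω q ^ s` in the dimension vector of the
extra node. -/
noncomputable def singleState (V : Type*) (s ω : ℤ) (d : {d : Option V →₀ ℕ // d ≠ 0}) :
    LaurentSeries ℤ :=
  if d = extraDim V then HahnSeries.single s ω else 0

/-- The BPS spectrum of `Qinf` is the spectrum of the augmented quiver `Qplus` without the single
state `ω q ^ s` of the extra node. All three quivers have a unique family of DT invariants; the one
of the extra node alone is the single state; `Qinf` has no state in the dimension vector of the extra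
node; and `Ω_{Qplus}` is the sum of `Ω_{Qinf}` and the single state. -/
def SpectrumEqMinusExtraNode {V W : Type*} (Qinf : SymQuiver W (Option V))
    (Qplus : SymQuiver (Option V) (Option V)) (s ω : ℤ) : Prop :=
  (∃! Ω, IsDTInvariants Qinf Ω) ∧
  (∃! Ω, IsDTInvariants Qplus Ω) ∧
  (∃! Ω, IsDTInvariants (Qplus.subquiver (⟨fun _ => none, fun _ _ _ => rfl⟩ : Unit ↪ Option V)) Ω) ∧
  IsDTInvariants (Qplus.subquiver (⟨fun _ => none, fun _ _ _ => rfl⟩ : Unit ↪ Option V))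
    (singleState V s ω) ∧
  ∀ Ωinf Ωplus, IsDTInvariants Qinf Ωinf → IsDTInvariants Qplus Ωplus →
    Ωinf (extraDim V) = 0 ∧ ∀ d, Ωinf d = Ωplus d - singleState V s ω d

/-! The exponents of a product of quantum dilogarithms are determined by the product, and they add
when products are multiplied. Hence it suffices to prove that the series of the union times the
series `E(x₀)` of the extra node is the series of the augmented quiver, and that `E` is itself the
dilogarithm product of a single state.

Let `N` be the total dimension at the split nodes. Joining the extra node by `z` arrows replaces
`x₀` by `q^{2zN} x₀` in its series, so the augmented series is the sum over `d` of the term of `d`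
times `E(q^{2zN} x₀)`. Put `W N = E(q^{2zN} x₀) / E(x₀)`, a finite product of factors `1 - x₀ q^s`
or of their inverses, by the functional equation of `E`. What remains is that the series of the
union equals the series of the initial quiver in which `d` has the weight `W N`.

This weighted series is invariant under splitting (`IsSplitting.weightedSeries_eq`). Merging each
copy with its original sends a dimension vector of the split quiver to a vector `d` and the part `r`
sitting on the copies. The two terms differ by Gaussian binomials, by `q²` to a number of
inversions, and by a factor that depends only on `N` and on the total of `r`. The `q`-Vandermonde
identity `sum_prod_qChoose` sums this over all `r` with a given total, for every permutation, and
leaves the identity `IsSplitWeight` in one summation variable, which holds in both cases. After `i`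
steps the nodes to be split carry `x₀ ^ i`; below that degree only vectors vanishing on them count,
with weight `W 0 = 1`, so the invariant weighted series is that of the union.

The infinite products are controlled by two filtrations. One bounds the powers of `q` linearly in
the degree and gives convergence and multiplicativity. The other is by degree: the lowest
coefficient of a product is `-Ω_e / (1 - q²)`, which gives existence and uniqueness of the spectrum.
-/

/-- Formal power series in the variables `x_t`, `t : τ`, with coefficients in `ℤ((q))`. -/
abbrev QSeries (τ : Type*) := MvPowerSeries τ (LaurentSeries ℤ)

/-- The series whose coefficients at `x ^ e`, for `e ≤ e₀`, have no power of `q` below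
`T - a |e|`. -/
def slopeFiltration {τ : Type*} (a : ℕ) (e₀ : τ →₀ ℕ) (T : ℤ) : AddSubgroup (QSeries τ) where
  carrier := {f | ∀ e ≤ e₀, ∀ t < T - a * e.degree, (MvPowerSeries.coeff e f).coeff t = 0}
  zero_mem' := by intro e _ t _; simp
  add_mem' := by
    intro f g hf hg e he t ht
    simp [hf e he t ht, hg e he t ht]
  neg_mem' := by
    intro f hf e he t ht
    simp [hf e he t ht]

/-! ### Power series filtered by a linear bound on the powers of `q` -/

section slopeFiltration

variable {τ : Type*} {a : ℕ} {e₀ : τ →₀ ℕ}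

theorem slopeFiltration_anti {T₁ T₂ : ℤ} (h : T₁ ≤ T₂) :
    slopeFiltration a e₀ T₂ ≤ slopeFiltration a e₀ T₁ :=
  fun _ hf e he t ht => hf e he t (by omega)

theorem LaurentSeries.coeff_mul_eq_zero {x y : LaurentSeries ℤ} {m n t : ℤ}
    (hx : ∀ i < m, x.coeff i = 0) (hy : ∀ i < n, y.coeff i = 0) (ht : t < m + n) :
    (x * y).coeff t = 0 := by
  rw [HahnSeries.coeff_mul]
  refine Finset.sum_eq_zero fun ij hij => ?_
  simp only [Finset.mem_antidiagonal, HahnSeries.mem_support] at hij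
  obtain ⟨_, _, h⟩ := hij
  by_cases h1 : ij.1 < m
  · rw [hx _ h1, zero_mul]
  · rw [hy _ (by omega), mul_zero]

/-- The bound is linear in the degree and degrees add under multiplication; this is why a slope is
used rather than a uniform bound on the powers of `q`. -/
theorem mul_mem_slopeFiltration {T₁ T₂ : ℤ} {f g : QSeries τ}
    (hf : f ∈ slopeFiltration a e₀ T₁) (hg : g ∈ slopeFiltration a e₀ T₂) :
    f * g ∈ slopeFiltration a e₀ (T₁ + T₂) := by
  classical
  intro e he t ht
  rw [MvPowerSeries.coeff_mul, HahnSeries.coeff_sum]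
  refine Finset.sum_eq_zero fun p hp => ?_
  rw [Finset.HasAntidiagonal.mem_antidiagonal] at hp
  have h1 : p.1 ≤ e := hp ▸ self_le_add_right _ _
  have h2 : p.2 ≤ e := hp ▸ self_le_add_left _ _
  refine LaurentSeries.coeff_mul_eq_zero (hf _ (h1.trans he)) (hg _ (h2.trans he)) ?_
  have : (e.degree : ℤ) = p.1.degree + p.2.degree := by rw [← hp, map_add]; push_cast; ring
  rw [this] at ht
  linarith [ht, mul_add (a : ℤ) p.1.degree p.2.degree]

theorem one_mem_slopeFiltration : (1 : QSeries τ) ∈ slopeFiltration a e₀ 0 := by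
  classical
  intro e _ t ht
  rw [MvPowerSeries.coeff_one]
  split_ifs with h
  · subst h
    rw [HahnSeries.coeff_one, if_neg]
    simp at ht
    omega
  · simp

/-- The units that are congruent to `1`, together with their inverses, modulo
`slopeFiltration a e₀ T`. -/
def slopeUnits {τ : Type*} (a : ℕ) (e₀ : τ →₀ ℕ) (T : ℕ) : Subgroup (QSeries τ)ˣ where
  carrier := {u | (u : QSeries τ) - 1 ∈ slopeFiltration a e₀ T ∧
    ((u⁻¹ : (QSeries τ)ˣ) : QSeries τ) - 1 ∈ slopeFiltration a e₀ T}
  one_mem' := by simp [zero_mem]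
  mul_mem' := by
    have key : ∀ f g : QSeries τ, f - 1 ∈ slopeFiltration a e₀ T →
        g - 1 ∈ slopeFiltration a e₀ T → f * g - 1 ∈ slopeFiltration a e₀ T := by
      intro f g hf hg
      have h : f * g - 1 = (f - 1) * (g - 1) + (f - 1) + (g - 1) := by ring
      rw [h]
      exact add_mem (add_mem (slopeFiltration_anti (by omega) (mul_mem_slopeFiltration hf hg)) hf) hg
    rintro u v ⟨hu, hu'⟩ ⟨hv, hv'⟩
    refine ⟨key _ _ hu hv, ?_⟩
    rw [mul_inv_rev, Units.val_mul]
    exact key _ _ hv' hu'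
  inv_mem' := by
    rintro u ⟨hu, hu'⟩
    exact ⟨hu', by simpa using hu⟩

theorem val_mem_slopeFiltration {u : (QSeries τ)ˣ} (hu : u ∈ slopeUnits a e₀ 0) :
    (u : QSeries τ) ∈ slopeFiltration a e₀ 0 := by
  simpa using add_mem hu.1 one_mem_slopeFiltration

theorem monomial_mem_slopeFiltration {T : ℤ} {d : τ →₀ ℕ} {s : ℤ}
    (h : d ≤ e₀ → T - a * d.degree ≤ s) :
    MvPowerSeries.monomial d (qPow s) ∈ slopeFiltration a e₀ T := by
  classical
  intro e he t ht
  rw [MvPowerSeries.coeff_monomial]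
  split_ifs with hed
  · subst hed
    rw [qPow, HahnSeries.coeff_single_of_ne]
    have := h he
    omega
  · simp

theorem val_dilogFactor (d : {d : τ →₀ ℕ // d ≠ 0}) (s : ℤ) :
    (dilogFactor d s : QSeries τ) = 1 - MvPowerSeries.monomial d.1 (qPow s) := rfl

theorem dilogFactor_mem_slopeUnits {T : ℕ} {d : {d : τ →₀ ℕ // d ≠ 0}} {s : ℤ}
    (h : d.1 ≤ e₀ → T - (a : ℤ) * d.1.degree ≤ s) :
    dilogFactor d s ∈ slopeUnits a e₀ T := by
  classical
  have hm : MvPowerSeries.monomial d.1 (qPow s) ∈ slopeFiltration a e₀ T :=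
    monomial_mem_slopeFiltration h
  -- The geometric series in recursive form. As `d ≠ 0`, the coefficient at `e` is expressed by one
  -- at a strictly smaller exponent.
  have hinv : ((dilogFactor d s)⁻¹ : (QSeries τ)ˣ) =
      1 + MvPowerSeries.monomial d.1 (qPow s) *
        (((dilogFactor d s)⁻¹ : (QSeries τ)ˣ) : QSeries τ) := by
    have := (dilogFactor d s).mul_inv
    rw [val_dilogFactor] at this
    linear_combination this
  have hmem : (((dilogFactor d s)⁻¹ : (QSeries τ)ˣ) : QSeries τ) ∈ slopeFiltration a e₀ 0 := by
    intro e
    induction e using WellFoundedLT.induction with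
    | _ e ih =>
    intro he t ht
    rw [hinv, map_add, HahnSeries.coeff_add, one_mem_slopeFiltration e he t ht, zero_add,
      MvPowerSeries.coeff_monomial_mul]
    split_ifs with hde
    · have hlt : e - d.1 < e := by
        refine lt_of_le_of_ne tsub_le_self fun h0 => d.2 ?_
        have h1 := add_tsub_cancel_of_le hde
        rw [h0] at h1
        simpa using h1
      have hs := h (hde.trans he)
      have hdeg : (e.degree : ℤ) = d.1.degree + (e - d.1).degree := by
        rw [← Nat.cast_add, ← map_add, add_tsub_cancel_of_le hde]
      rw [qPow, HahnSeries.coeff_single_mul, one_mul]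
      refine ih _ hlt (hlt.le.trans he) _ ?_
      rw [hdeg] at ht
      linarith [ht, mul_add (a : ℤ) d.1.degree (e - d.1).degree, (Nat.cast_nonneg T : (0:ℤ) ≤ T)]
    · simp
  refine ⟨?_, ?_⟩
  · rw [val_dilogFactor, sub_sub_cancel_left]
    exact neg_mem hm
  · rw [hinv, add_sub_cancel_left]
    simpa using mul_mem_slopeFiltration hm hmem

end slopeFiltration

/-! ### Convergence of the infinite product -/

/-- A family of candidates for the motivic DT invariants. -/
abbrev Spectrum (τ : Type*) := {d : τ →₀ ℕ // d ≠ 0} → LaurentSeries ℤ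

section Convergence

variable {τ : Type*}

/-- A finite partial product of `∏_{d, s, k} (1 - x ^ d q ^ (2 k + s)) ^ Ω_{d,s}`. -/
noncomputable def partialProd (Ω : Spectrum τ) (F : Finset ({d : τ →₀ ℕ // d ≠ 0} × ℤ × ℕ)) :
    (QSeries τ)ˣ :=
  ∏ p ∈ F, dilogFactor p.1 (2 * (p.2.2 : ℤ) + p.2.1) ^ ((Ω p.1).coeff p.2.1)

/-- The infinite product of the quantum dilogarithms with exponents `Ω` is `P`. -/
def HasDilogProd (Ω : Spectrum τ) (P : QSeries τ) : Prop :=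
  ∀ (e : τ →₀ ℕ) (t : ℤ), ∀ᶠ F in atTop,
    (MvPowerSeries.coeff e (partialProd Ω F : QSeries τ)).coeff t
      = (MvPowerSeries.coeff e P).coeff t

theorem partialProd_add (Ω Ω' : Spectrum τ) (F) :
    partialProd (Ω + Ω') F = partialProd Ω F * partialProd Ω' F := by
  simp [partialProd, zpow_add, Finset.prod_mul_distrib]

theorem HasDilogProd.unique {Ω : Spectrum τ} {P P' : QSeries τ} (h : HasDilogProd Ω P)
    (h' : HasDilogProd Ω P') : P = P' := by
  ext e t
  obtain ⟨F, h1, h2⟩ := ((h e t).and (h' e t)).exists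
  exact h1.symm.trans h2

/-- The powers of `q` in the spectrum are bounded below, in the dimension vectors up to `e₀`, by
`-a |d|`. -/
def SlopeBound (Ω : Spectrum τ) (e₀ : τ →₀ ℕ) (a : ℕ) : Prop :=
  ∀ d, d.1 ≤ e₀ → ∀ s, (Ω d).coeff s ≠ 0 → -(a * d.1.degree : ℤ) ≤ s

theorem SlopeBound.mono {Ω : Spectrum τ} {e₀ : τ →₀ ℕ} {a b : ℕ} (h : SlopeBound Ω e₀ a)
    (hab : a ≤ b) : SlopeBound Ω e₀ b := by
  intro d hd s hs
  have h1 := h d hd s hs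
  have h2 : a * d.1.degree ≤ b * d.1.degree := Nat.mul_le_mul_right _ hab
  have h3 : ((a * d.1.degree : ℕ) : ℤ) ≤ (b * d.1.degree : ℕ) := by exact_mod_cast h2
  push_cast at h3
  omega

theorem finite_le (e₀ : τ →₀ ℕ) : {d : {d : τ →₀ ℕ // d ≠ 0} | d.1 ≤ e₀}.Finite := by
  classical
  exact (Set.finite_Iic e₀).preimage Subtype.val_injective.injOn

/-- Only finitely many `d` lie below `e₀`, so their orders in `q` have a common lower bound; it
becomes a slope because `|d| ≥ 1`. -/
theorem exists_slopeBound (Ω : Spectrum τ) (e₀ : τ →₀ ℕ) : ∃ a, SlopeBound Ω e₀ a := by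
  obtain ⟨b, hb⟩ := ((finite_le e₀).image fun d => (Ω d).order).bddBelow
  refine ⟨b.natAbs, fun d hd s hs => ?_⟩
  have h1 : b ≤ (Ω d).order := hb ⟨d, hd, rfl⟩
  have h2 : (Ω d).order ≤ s := HahnSeries.order_le_of_coeff_ne_zero hs
  have h3 : 1 ≤ d.1.degree := Nat.one_le_iff_ne_zero.2 fun h => d.2 ((Finsupp.degree_eq_zero_iff _).1 h)
  have h4 : (b.natAbs : ℤ) * 1 ≤ b.natAbs * d.1.degree :=
    mul_le_mul_of_nonneg_left (by exact_mod_cast h3) (by positivity)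
  omega

theorem partialProd_mem_slopeUnits_zero {Ω : Spectrum τ} {e₀ : τ →₀ ℕ} {a : ℕ}
    (h : SlopeBound Ω e₀ a) (F) : partialProd Ω F ∈ slopeUnits a e₀ 0 := by
  refine Subgroup.prod_mem _ fun p _ => ?_
  by_cases h0 : (Ω p.1).coeff p.2.1 = 0
  · rw [h0, zpow_zero]; exact one_mem _
  · refine Subgroup.zpow_mem _ (dilogFactor_mem_slopeUnits fun hp => ?_) _
    have := h _ hp _ h0
    push_cast
    omega

/-- The Cauchy property of the partial products: all but finitely many factors are congruent to `1`
at level `T`. -/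
theorem eventually_partialProd_sub_mem {Ω : Spectrum τ} {e₀ : τ →₀ ℕ} {a : ℕ}
    (h : SlopeBound Ω e₀ a) (T : ℕ) : ∃ F₀, ∀ F, F₀ ⊆ F →
      (partialProd Ω F : QSeries τ) - partialProd Ω F₀ ∈ slopeFiltration a e₀ T := by
  classical
  have hfin : {p : {d : τ →₀ ℕ // d ≠ 0} × ℤ × ℕ | p.1.1 ≤ e₀ ∧
      -(a * p.1.1.degree : ℤ) ≤ p.2.1 ∧ 2 * (p.2.2 : ℤ) + p.2.1 < T - a * p.1.1.degree}.Finite := by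
    have hN : ∃ N : ℕ, ∀ d ∈ {d : {d : τ →₀ ℕ // d ≠ 0} | d.1 ≤ e₀}, a * d.1.degree ≤ N := by
      obtain ⟨N, hN⟩ := ((finite_le e₀).image fun d => a * d.1.degree).bddAbove
      exact ⟨N, fun d hd => hN ⟨d, hd, rfl⟩⟩
    obtain ⟨N, hN⟩ := hN
    -- The lower bound on `s` and the upper bound on `2k + s` together force `2k < T`, so `k` is
    -- bounded as well.
    refine ((finite_le e₀).prod ((Set.finite_Icc (-(N : ℤ)) T).prod (Set.finite_Iic T))).subset ?_
    rintro ⟨d, s, k⟩ ⟨h1, h2, h3⟩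
    have := hN d h1
    have : ((a * d.1.degree : ℕ) : ℤ) ≤ N := by exact_mod_cast this
    push_cast at this
    simp only at h2 h3
    have h4 : (0:ℤ) ≤ a * d.1.degree := by positivity
    refine ⟨h1, ⟨?_, ?_⟩, ?_⟩ <;> simp <;> omega
  refine ⟨hfin.toFinset, fun F hF => ?_⟩
  have hsplit : partialProd Ω F = partialProd Ω hfin.toFinset * partialProd Ω (F \ hfin.toFinset) := by
    rw [mul_comm]
    exact (Finset.prod_sdiff hF).symm
  have hmem : partialProd Ω (F \ hfin.toFinset) ∈ slopeUnits a e₀ T := by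
    refine Subgroup.prod_mem _ fun p hp => ?_
    by_cases h0 : (Ω p.1).coeff p.2.1 = 0
    · rw [h0, zpow_zero]; exact one_mem _
    · refine Subgroup.zpow_mem _ (dilogFactor_mem_slopeUnits fun hpe => ?_) _
      by_contra hlt
      refine (Finset.mem_sdiff.1 hp).2 (hfin.mem_toFinset.2 ⟨hpe, h _ hpe _ h0, by omega⟩)
  rw [hsplit, Units.val_mul]
  have := mul_mem_slopeFiltration
    (val_mem_slopeFiltration (partialProd_mem_slopeUnits_zero h hfin.toFinset)) hmem.1
  rwa [zero_add, mul_sub, mul_one] at this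

theorem exists_hasDilogProd (Ω : Spectrum τ) : ∃ P, HasDilogProd Ω P := by
  have key : ∀ e : τ →₀ ℕ, ∃ x : LaurentSeries ℤ, ∀ t, ∀ᶠ F in atTop,
      (MvPowerSeries.coeff e (partialProd Ω F : QSeries τ)).coeff t = x.coeff t := by
    intro e
    obtain ⟨a, ha⟩ := exists_slopeBound Ω e
    have h1 : ∀ t : ℤ, ∃ c : ℤ, ∀ᶠ F in atTop,
        (MvPowerSeries.coeff e (partialProd Ω F : QSeries τ)).coeff t = c := by
      intro t
      -- The level is chosen so that `t` lies below `T - a |e|`, where the filtration forces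
      -- coefficients to agree.
      obtain ⟨F₀, hF₀⟩ := eventually_partialProd_sub_mem ha (t + a * e.degree + 1).toNat
      refine ⟨(MvPowerSeries.coeff e (partialProd Ω F₀ : QSeries τ)).coeff t,
        (eventually_ge_atTop F₀).mono fun F hF => sub_eq_zero.1 ?_⟩
      have := hF₀ F hF e le_rfl t (by omega)
      rwa [map_sub, HahnSeries.coeff_sub] at this
    choose c hc using h1
    have hb : BddBelow (Function.support c) := by
      refine ⟨-(a * e.degree : ℤ), fun t ht => ?_⟩
      by_contra hlt
      refine ht ?_
      obtain ⟨F, hF⟩ := (hc t).exists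
      rw [← hF]
      exact val_mem_slopeFiltration (partialProd_mem_slopeUnits_zero ha F) e le_rfl t (by omega)
    exact ⟨HahnSeries.ofSuppBddBelow c hb, fun t => by simpa using hc t⟩
  choose P hP using key
  exact ⟨P, fun e t => hP e t⟩

/-- Convergence holds uniformly for all exponents below `e₀` and all powers of `q` under the level,
which is the form needed to multiply limits. -/
theorem HasDilogProd.eventually_sub_mem {Ω : Spectrum τ} {P : QSeries τ} (hP : HasDilogProd Ω P)
    {e₀ : τ →₀ ℕ} {a : ℕ} (h : SlopeBound Ω e₀ a) (T : ℕ) :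
    ∀ᶠ F in atTop, (partialProd Ω F : QSeries τ) - P ∈ slopeFiltration a e₀ T := by
  obtain ⟨F₀, hF₀⟩ := eventually_partialProd_sub_mem h T
  have h0 : (partialProd Ω F₀ : QSeries τ) - P ∈ slopeFiltration a e₀ T := by
    intro e he t ht
    obtain ⟨F, hF, hF'⟩ := ((hP e t).and (eventually_ge_atTop F₀)).exists
    have := hF₀ F hF' e he t ht
    rw [map_sub, HahnSeries.coeff_sub] at this ⊢
    rw [← hF]
    linarith
  filter_upwards [eventually_ge_atTop F₀] with F hF
  simpa using add_mem (hF₀ F hF) h0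

theorem HasDilogProd.mem_slopeFiltration {Ω : Spectrum τ} {P : QSeries τ} (hP : HasDilogProd Ω P)
    {e₀ : τ →₀ ℕ} {a : ℕ} (h : SlopeBound Ω e₀ a) : P ∈ slopeFiltration a e₀ 0 := by
  obtain ⟨F, hF⟩ := (hP.eventually_sub_mem h 0).exists
  simpa using sub_mem (val_mem_slopeFiltration (partialProd_mem_slopeUnits_zero h F)) hF

theorem HasDilogProd.add {Ω Ω' : Spectrum τ} {P P' : QSeries τ} (hP : HasDilogProd Ω P)
    (hP' : HasDilogProd Ω' P') : HasDilogProd (Ω + Ω') (P * P') := by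
  intro e t
  obtain ⟨a₁, h₁⟩ := exists_slopeBound Ω e
  obtain ⟨a₂, h₂⟩ := exists_slopeBound Ω' e
  replace h₁ := h₁.mono (le_max_left a₁ a₂)
  replace h₂ := h₂.mono (le_max_right a₁ a₂)
  set a := max a₁ a₂
  set T := (t + a * e.degree + 1).toNat
  filter_upwards [hP.eventually_sub_mem h₁ T, hP'.eventually_sub_mem h₂ T] with F hF hF'
  have h3 : (partialProd (Ω + Ω') F : QSeries τ) - P * P' ∈ slopeFiltration a e T := by
    -- The usual splitting of a difference of products; both summands are small because one factor
    -- is small and the other has level `0`.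
    have h4 : (partialProd (Ω + Ω') F : QSeries τ) - P * P' =
        partialProd Ω F * (partialProd Ω' F - P') + (partialProd Ω F - P) * P' := by
      rw [partialProd_add, Units.val_mul]; ring
    rw [h4]
    refine add_mem ?_ ?_
    · simpa using mul_mem_slopeFiltration
        (val_mem_slopeFiltration (partialProd_mem_slopeUnits_zero h₁ F)) hF'
    · simpa using mul_mem_slopeFiltration hF (hP'.mem_slopeFiltration h₂)
  have := h3 e le_rfl t (by omega)
  rw [map_sub, HahnSeries.coeff_sub] at this
  linarith

end Convergence

/-! ### The degree filtration, and existence and uniqueness of the spectrum -/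

section Degree

variable {τ : Type*}

/-- The power series whose terms all have degree at least `n`. -/
def degreeIdeal (τ : Type*) (n : ℕ) : Ideal (QSeries τ) where
  carrier := {f | ∀ e : τ →₀ ℕ, e.degree < n → MvPowerSeries.coeff e f = 0}
  zero_mem' := by intro e _; simp
  add_mem' := by
    intro f g hf hg e he
    rw [map_add, hf e he, hg e he, add_zero]
  smul_mem' := by
    classical
    intro f g hg e he
    rw [smul_eq_mul, MvPowerSeries.coeff_mul]
    refine Finset.sum_eq_zero fun p hp => ?_
    rw [Finset.HasAntidiagonal.mem_antidiagonal] at hp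
    rw [hg, mul_zero]
    rw [← hp, map_add] at he
    omega

theorem mul_mem_degreeIdeal {m n : ℕ} {f g : QSeries τ} (hf : f ∈ degreeIdeal τ m)
    (hg : g ∈ degreeIdeal τ n) : f * g ∈ degreeIdeal τ (m + n) := by
  classical
  intro e he
  rw [MvPowerSeries.coeff_mul]
  refine Finset.sum_eq_zero fun p hp => ?_
  rw [Finset.HasAntidiagonal.mem_antidiagonal] at hp
  rw [← hp, map_add] at he
  by_cases h : p.1.degree < m
  · rw [hf _ h, zero_mul]
  · rw [hg _ (by omega), mul_zero]

/-- The units that are congruent to `1` in degrees below `n`. -/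
def degreeUnits (τ : Type*) (n : ℕ) : Subgroup (QSeries τ)ˣ where
  carrier := {u | (u : QSeries τ) - 1 ∈ degreeIdeal τ n}
  one_mem' := by simp
  mul_mem' := by
    intro u v hu hv
    have h : ((u * v : (QSeries τ)ˣ) : QSeries τ) - 1 = u * (v - 1) + (u - 1) := by
      rw [Units.val_mul]; ring
    rw [Set.mem_ofPred_eq, h]
    exact add_mem (Ideal.mul_mem_left _ _ hv) hu
  inv_mem' := by
    intro u hu
    have h : ((u⁻¹ : (QSeries τ)ˣ) : QSeries τ) - 1 = -(u⁻¹ : (QSeries τ)ˣ) * (u - 1) := by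
      rw [mul_sub, neg_mul, Units.inv_mul]; ring
    rw [Set.mem_ofPred_eq, h]
    exact Ideal.mul_mem_left _ _ hu

/-- The coefficient at `x ^ e`, as a homomorphism on the units congruent to `1` below `|e|`. -/
noncomputable def leadingCoeffHom (e : τ →₀ ℕ) (he : e ≠ 0) :
    degreeUnits τ e.degree →* Multiplicative (LaurentSeries ℤ) where
  toFun u := Multiplicative.ofAdd (MvPowerSeries.coeff e ((u : (QSeries τ)ˣ) - 1 : QSeries τ))
  map_one' := by simp
  map_mul' := by
    intro u v
    have h : (((u * v : degreeUnits τ e.degree) : (QSeries τ)ˣ) : QSeries τ) - 1 =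
        ((u : (QSeries τ)ˣ) - 1 : QSeries τ) * ((v : (QSeries τ)ˣ) - 1)
          + ((u : (QSeries τ)ˣ) - 1) + ((v : (QSeries τ)ˣ) - 1) := by
      rw [Subgroup.coe_mul, Units.val_mul]; ring
    have hpos : 0 < e.degree := Nat.pos_of_ne_zero fun h => he ((Finsupp.degree_eq_zero_iff _).1 h)
    rw [h, ← ofAdd_add, map_add (MvPowerSeries.coeff e), map_add (MvPowerSeries.coeff e),
      mul_mem_degreeIdeal u.2 v.2 e (by omega), zero_add]

theorem dilogFactor_mem_degreeUnits {n : ℕ} {d : {d : τ →₀ ℕ // d ≠ 0}} (h : n ≤ d.1.degree)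
    (s : ℤ) : dilogFactor d s ∈ degreeUnits τ n := by
  classical
  change (dilogFactor d s : QSeries τ) - 1 ∈ degreeIdeal τ n
  rw [val_dilogFactor, sub_sub_cancel_left]
  refine neg_mem fun e he => ?_
  rw [MvPowerSeries.coeff_monomial, if_neg]
  rintro rfl
  omega

theorem degreeFactor_mem {Ω : Spectrum τ} {n : ℕ}
    (h : ∀ d, d.1.degree < n → Ω d = 0) (p : {d : τ →₀ ℕ // d ≠ 0} × ℤ × ℕ) :
    dilogFactor p.1 (2 * (p.2.2 : ℤ) + p.2.1) ^ ((Ω p.1).coeff p.2.1) ∈ degreeUnits τ n := by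
  by_cases hp : p.1.1.degree < n
  · rw [h _ hp, HahnSeries.coeff_zero, zpow_zero]
    exact one_mem _
  · exact Subgroup.zpow_mem _ (dilogFactor_mem_degreeUnits (by omega) _) _

/-- On the group of units congruent to `1` below degree `|e|` the coefficient at `x ^ e` is
additive, so the product becomes a sum to which only the factors with `d = e` contribute. -/
theorem coeff_partialProd {Ω : Spectrum τ} (e : {d : τ →₀ ℕ // d ≠ 0})
    (h : ∀ d, d.1.degree < e.1.degree → Ω d = 0) (F) [DecidableEq τ] :
    MvPowerSeries.coeff e.1 (partialProd Ω F : QSeries τ)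
      = -∑ p ∈ F, if p.1 = e then (Ω e).coeff p.2.1 • qPow (2 * (p.2.2 : ℤ) + p.2.1) else 0 := by
  have hF : (⟨partialProd Ω F, Subgroup.prod_mem _ fun p _ => degreeFactor_mem h p⟩ :
      degreeUnits τ e.1.degree) = ∏ p ∈ F, ⟨_, degreeFactor_mem h p⟩ := by
    ext1
    rw [Subgroup.val_finsetProd]
    rfl
  have h1 := congrArg (fun u => (leadingCoeffHom e.1 e.2 u).toAdd) hF
  simp only [map_prod, toAdd_prod] at h1
  have h2 : MvPowerSeries.coeff e.1 (1 : QSeries τ) = 0 := by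
    rw [MvPowerSeries.coeff_one, if_neg e.2]
  have h3 : (leadingCoeffHom e.1 e.2 ⟨partialProd Ω F, Subgroup.prod_mem _ fun p _ =>
      degreeFactor_mem h p⟩).toAdd = MvPowerSeries.coeff e.1 (partialProd Ω F : QSeries τ) := by
    simp [leadingCoeffHom, h2]
  rw [← h3, h1, ← Finset.sum_neg_distrib]
  refine Finset.sum_congr rfl fun p _ => ?_
  by_cases hlt : p.1.1.degree < e.1.degree
  · have hne : p.1 ≠ e := by rintro rfl; omega
    simp [leadingCoeffHom, h _ hlt, hne]
  · have hz : (⟨_, degreeFactor_mem h p⟩ : degreeUnits τ e.1.degree) =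
        (⟨dilogFactor p.1 (2 * (p.2.2 : ℤ) + p.2.1), dilogFactor_mem_degreeUnits (by omega) _⟩ :
          degreeUnits τ e.1.degree) ^ ((Ω p.1).coeff p.2.1) := by
      ext1; simp
    rw [hz, map_zpow, toAdd_zpow]
    have hl : (leadingCoeffHom e.1 e.2 ⟨dilogFactor p.1 (2 * (p.2.2 : ℤ) + p.2.1),
        dilogFactor_mem_degreeUnits (by omega) _⟩).toAdd
        = -(if p.1 = e then qPow (2 * (p.2.2 : ℤ) + p.2.1) else 0) := by
      simp only [leadingCoeffHom, MonoidHom.coe_mk, OneHom.coe_mk, toAdd_ofAdd, val_dilogFactor,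
        sub_sub_cancel_left, map_neg, MvPowerSeries.coeff_monomial]
      simp only [Subtype.ext_iff, eq_comm]
    rw [hl]
    split_ifs with hpe
    · rw [hpe, smul_neg]
    · simp

theorem HasDilogProd.sub_one_mem {Ω : Spectrum τ} {P : QSeries τ} (hP : HasDilogProd Ω P) {n : ℕ}
    (h : ∀ d, d.1.degree < n → Ω d = 0) : P - 1 ∈ degreeIdeal τ n := by
  intro e he
  ext t
  obtain ⟨F, hF⟩ := (hP e t).exists
  have h1 : partialProd Ω F ∈ degreeUnits τ n :=
    Subgroup.prod_mem _ fun p _ => degreeFactor_mem h p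
  have h2 := congrArg (fun x => HahnSeries.coeff x t) (h1 e he)
  simp only [map_sub, HahnSeries.coeff_sub] at h2 ⊢
  rw [← hF, h2]

theorem exists_coeff_sub_eq_zero (x : LaurentSeries ℤ) (t : ℤ) :
    ∃ K : ℕ, ∀ k ≥ K, x.coeff (t - 2 * k) = 0 := by
  refine ⟨(t - x.order + 1).toNat, fun k hk => ?_⟩
  refine HahnSeries.coeff_eq_zero_of_lt_order ?_
  omega

theorem coeff_smul_qPow (c s t : ℤ) : (c • qPow s).coeff t = if t = s then c else 0 := by
  classical
  rw [HahnSeries.coeff_smul, qPow, HahnSeries.coeff_single]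
  split_ifs <;> simp

/-- The power `q ^ t` arises only from the triples `(e, t - 2k, k)`, and those with `k ≥ K` have
exponent zero. -/
theorem eventually_sum_eq (x : LaurentSeries ℤ) (e : {d : τ →₀ ℕ // d ≠ 0}) (t : ℤ) {K : ℕ}
    (hK : ∀ k ≥ K, x.coeff (t - 2 * k) = 0) [DecidableEq τ] :
    ∀ᶠ F : Finset ({d : τ →₀ ℕ // d ≠ 0} × ℤ × ℕ) in atTop,
      (∑ p ∈ F, if p.1 = e then x.coeff p.2.1 • qPow (2 * (p.2.2 : ℤ) + p.2.1) else 0).coeff t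
        = ∑ k ∈ Finset.range K, x.coeff (t - 2 * k) := by
  set F₀ : Finset ({d : τ →₀ ℕ // d ≠ 0} × ℤ × ℕ) :=
    (Finset.range K).image fun k : ℕ => (e, t - 2 * (k : ℤ), k)
  filter_upwards [eventually_ge_atTop F₀] with F hF
  have h1 : ∀ p : {d : τ →₀ ℕ // d ≠ 0} × ℤ × ℕ,
      (if p.1 = e then x.coeff p.2.1 • qPow (2 * (p.2.2 : ℤ) + p.2.1) else 0).coeff t
        = if p.1 = e ∧ p.2.1 = t - 2 * p.2.2 then x.coeff (t - 2 * p.2.2) else 0 := by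
    intro p
    by_cases hp : p.1 = e
    · by_cases hs : p.2.1 = t - 2 * p.2.2
      · have : t = 2 * (p.2.2 : ℤ) + p.2.1 := by omega
        rw [if_pos hp, if_pos ⟨hp, hs⟩, ← hs]
        rw [← this, coeff_smul_qPow, if_pos rfl]
      · have : t ≠ 2 * (p.2.2 : ℤ) + p.2.1 := by omega
        rw [if_pos hp, if_neg (by tauto)]
        rw [coeff_smul_qPow, if_neg this]
    · rw [if_neg hp, if_neg (by tauto), HahnSeries.coeff_zero]
  rw [HahnSeries.coeff_sum, Finset.sum_congr rfl fun p _ => h1 p, ← Finset.sum_subset hF]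
  · rw [Finset.sum_image (by intro a _ b _ hab; exact (Prod.ext_iff.1 (Prod.ext_iff.1 hab).2).2)]
    simp
  · intro p _ hp
    rw [ite_eq_right_iff]
    rintro ⟨hp1, hp2⟩
    refine hK _ ?_
    by_contra hlt
    refine hp (Finset.mem_image.2 ⟨p.2.2, Finset.mem_range.2 (by omega), ?_⟩)
    rw [← hp1, ← hp2]

/-- The lowest coefficient is `-Ω_e ∑_k q^{2k} = -Ω_e / (1 - q²)`. -/
theorem HasDilogProd.coeff_eq {Ω : Spectrum τ} {P : QSeries τ} (hP : HasDilogProd Ω P)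
    (e : {d : τ →₀ ℕ // d ≠ 0}) (h : ∀ d, d.1.degree < e.1.degree → Ω d = 0) :
    Ω e = -((1 - qPow 2) * MvPowerSeries.coeff e.1 P) := by
  classical
  have key : ∀ t K, (∀ k ≥ K, (Ω e).coeff (t - 2 * (k : ℕ)) = 0) →
      (MvPowerSeries.coeff e.1 P).coeff t = -∑ k ∈ Finset.range K, (Ω e).coeff (t - 2 * k) := by
    intro t K hK
    obtain ⟨F, hF1, hF2⟩ := ((hP e.1 t).and (eventually_sum_eq (Ω e) e t hK)).exists
    rw [← hF1, coeff_partialProd e h, HahnSeries.coeff_neg, hF2]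
  ext t
  obtain ⟨K, hK⟩ := exists_coeff_sub_eq_zero (Ω e) t
  -- The truncations at `K + 1` for `t` and at `K` for `t - 2` have the same terms except the one
  -- with `k = 0`, so their difference is a single coefficient of `Ω e`.
  have h1 := key t (K + 1) fun k hk => hK k (by omega)
  have h2 := key (t - 2) K fun k hk => by
    have := hK (k + 1) (by omega)
    push_cast at this
    rwa [sub_sub, show (2 : ℤ) + 2 * k = 2 * (k + 1) by ring]
  rw [Finset.sum_range_succ'] at h1
  have h3 : ∀ k : ℕ, t - 2 - 2 * (k : ℤ) = t - 2 * ((k + 1 : ℕ) : ℤ) := by intro k; push_cast; ring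
  simp only [h3] at h2
  rw [HahnSeries.coeff_neg, sub_mul, one_mul, HahnSeries.coeff_sub, qPow,
    HahnSeries.coeff_single_mul, h1, h2]
  simp

theorem HasDilogProd.constantCoeff {Ω : Spectrum τ} {P : QSeries τ} (hP : HasDilogProd Ω P) :
    MvPowerSeries.constantCoeff P = 1 := by
  have := hP.sub_one_mem (n := 1) (fun d hd => absurd ((Finsupp.degree_eq_zero_iff _).1 (by omega)) d.2)
    0 (by simp)
  rw [map_sub, sub_eq_zero] at this
  simpa using this

theorem HasDilogProd.isUnit {Ω : Spectrum τ} {P : QSeries τ} (hP : HasDilogProd Ω P) :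
    IsUnit P := by
  rw [MvPowerSeries.isUnit_iff_constantCoeff, hP.constantCoeff]
  exact isUnit_one

/-- The difference of the spectra has product `1`. A nonzero entry of least degree would appear in a
coefficient of that product by `HasDilogProd.coeff_eq`. -/
theorem HasDilogProd.spectrum_unique {Ω Ω' : Spectrum τ} {P : QSeries τ} (h : HasDilogProd Ω P)
    (h' : HasDilogProd Ω' P) : Ω = Ω' := by
  obtain ⟨P₁, h₁⟩ := exists_hasDilogProd (Ω - Ω')
  have h2 := h₁.add h'
  rw [sub_add_cancel] at h2
  have h3 : P₁ = 1 := by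
    have := h2.unique h
    rw [← one_mul P, ← mul_assoc, mul_one] at this
    exact h.isUnit.mul_right_cancel this
  subst h3
  rw [← sub_eq_zero]
  by_contra hne
  have hex : ∃ n, ∃ d : {d : τ →₀ ℕ // d ≠ 0}, d.1.degree = n ∧ (Ω - Ω') d ≠ 0 := by
    obtain ⟨d, hd⟩ := Function.ne_iff.1 hne
    exact ⟨_, d, rfl, hd⟩
  classical
  obtain ⟨d, hd, hd'⟩ := Nat.find_spec hex
  refine hd' ?_
  rw [h₁.coeff_eq d, MvPowerSeries.coeff_one, if_neg d.2, mul_zero, neg_zero]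
  intro d₂ hlt
  by_contra h0
  exact Nat.find_min hex (hd ▸ hlt) ⟨d₂, rfl, h0⟩

theorem isUnit_one_sub_qPow_two : IsUnit (1 - qPow 2) := by
  have := isUnit_qPoch 1
  simpa [qPoch, qPow] using this

/-- A spectrum whose product agrees with `P` in degrees at most `n`, extending the given one. -/
theorem exists_spectrum_step {P : QSeries τ} {n : ℕ} (Ω : Spectrum τ)
    (h : ∀ P', HasDilogProd Ω P' → P' - P ∈ degreeIdeal τ (n + 1)) :
    ∃ Ω' : Spectrum τ, (∀ d, d.1.degree ≠ n + 1 → Ω' d = Ω d) ∧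
      ∀ P', HasDilogProd Ω' P' → P' - P ∈ degreeIdeal τ (n + 2) := by
  classical
  obtain ⟨P₁, h₁⟩ := exists_hasDilogProd Ω
  obtain ⟨u, rfl⟩ := h₁.isUnit
  set ρ : QSeries τ := (u⁻¹ : (QSeries τ)ˣ) * P
  have hρ : ρ - 1 ∈ degreeIdeal τ (n + 1) := by
    have : ρ - 1 = -((u⁻¹ : (QSeries τ)ˣ) : QSeries τ) * (u - P) := by
      rw [mul_sub, neg_mul, neg_mul, Units.inv_mul]; ring
    rw [this]
    exact Ideal.mul_mem_left _ _ (h _ h₁)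
  -- The correction is dictated by `HasDilogProd.coeff_eq`: its product has the same coefficients as
  -- `ρ` in degree `n + 1`.
  set c : Spectrum τ := fun d =>
    if d.1.degree = n + 1 then -((1 - qPow 2) * MvPowerSeries.coeff d.1 ρ) else 0 with hc
  obtain ⟨P₂, h₂⟩ := exists_hasDilogProd c
  have hc0 : ∀ d, d.1.degree < n + 1 → c d = 0 := fun d hd => by
    rw [hc]; exact if_neg (by omega)
  refine ⟨Ω + c, fun d hd => ?_, fun P' hP' => ?_⟩
  · rw [Pi.add_apply, hc]
    simp [hd]
  · have h3 := (h₁.add h₂).unique hP'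
    have h4 : P₂ - ρ ∈ degreeIdeal τ (n + 2) := by
      intro e he
      by_cases hen : e.degree < n + 1
      · have := sub_mem (h₂.sub_one_mem hc0) hρ e hen
        simpa using this
      · have he' : e.degree = n + 1 := by omega
        have he0 : e ≠ 0 := by rintro rfl; simp at he'
        have := h₂.coeff_eq ⟨e, he0⟩ (fun d hd => hc0 d (by simpa [he'] using hd))
        rw [hc] at this
        simp only [he', if_true, neg_inj] at this
        rw [map_sub, sub_eq_zero]
        exact (isUnit_one_sub_qPow_two.mul_left_cancel this).symm
    have h5 : P' - P = u * (P₂ - ρ) := by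
      rw [← h3, mul_sub, Units.mul_inv_cancel_left]
    rw [h5]
    exact Ideal.mul_mem_left _ _ h4

/-- The spectrum is built degree by degree. The entry at `d` is final from step `|d|` on, so the
spectra of the steps have a limit. -/
theorem exists_hasDilogProd_of_constantCoeff {P : QSeries τ}
    (hP : MvPowerSeries.constantCoeff P = 1) : ∃ Ω, HasDilogProd Ω P := by
  have h0 : ∀ P', HasDilogProd (0 : Spectrum τ) P' → P' - P ∈ degreeIdeal τ (0 + 1) := by
    intro P' hP' e he
    obtain rfl : e = 0 := (Finsupp.degree_eq_zero_iff _).1 (by omega)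
    have := hP'.constantCoeff
    rw [MvPowerSeries.coeff_zero_eq_constantCoeff_apply, map_sub, this, hP, sub_self]
  let S : (n : ℕ) → {Ω : Spectrum τ // ∀ P', HasDilogProd Ω P' → P' - P ∈ degreeIdeal τ (n + 1)} :=
    fun n => Nat.rec ⟨0, h0⟩ (fun n Ω => ⟨(exists_spectrum_step Ω.1 Ω.2).choose,
      (exists_spectrum_step Ω.1 Ω.2).choose_spec.2⟩) n
  have hS : ∀ n d, d.1.degree ≠ n + 1 → (S (n + 1)).1 d = (S n).1 d := fun n =>
    (exists_spectrum_step (S n).1 (S n).2).choose_spec.1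
  have hS' : ∀ n d, d.1.degree ≤ n → (S n).1 d = (S d.1.degree).1 d := by
    intro n d hd
    induction n, hd using Nat.le_induction with
    | base => rfl
    | succ n hn ih => rw [hS n d (by omega), ih]
  refine ⟨fun d => (S d.1.degree).1 d, ?_⟩
  set Ω : Spectrum τ := fun d => (S d.1.degree).1 d
  obtain ⟨P₁, h₁⟩ := exists_hasDilogProd Ω
  suffices P₁ = P by rwa [this] at h₁
  have key : ∀ n, P₁ - P ∈ degreeIdeal τ (n + 1) := by
    intro n
    obtain ⟨P₂, h₂⟩ := exists_hasDilogProd (S n).1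
    obtain ⟨P₃, h₃⟩ := exists_hasDilogProd (Ω - (S n).1)
    have h4 := (h₃.add h₂)
    rw [sub_add_cancel] at h4
    have h5 : P₁ - P = P₂ * (P₃ - 1) + (P₂ - P) := by
      rw [← h4.unique h₁]; ring
    rw [h5]
    refine add_mem (Ideal.mul_mem_left _ _ (h₃.sub_one_mem fun d hd => ?_)) ((S n).2 _ h₂)
    rw [Pi.sub_apply, hS' n d (by omega), sub_self]
  ext1 e
  have := key e.degree e (Nat.lt_succ_self _)
  rwa [map_sub, sub_eq_zero] at this

theorem existsUnique_isDTInvariants {ι : Type*} {Q : SymQuiver ι τ} (hQ : Q.IsLocallyFinite)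
    (h : MvPowerSeries.constantCoeff Q.motivicSeries = 1) : ∃! Ω, IsDTInvariants Q Ω := by
  obtain ⟨Ω, hΩ⟩ := exists_hasDilogProd_of_constantCoeff h
  exact ⟨Ω, ⟨hQ, hΩ⟩, fun Ω' hΩ' => HasDilogProd.spectrum_unique hΩ'.2 hΩ⟩

end Degree

/-! ### Gaussian binomial coefficients -/

/-- The Gaussian binomial coefficients, by the `q`-Pascal rule. -/
def qChoose {R : Type*} [CommRing R] (p : R) : ℕ → ℕ → R
  | _, 0 => 1
  | 0, _ + 1 => 0
  | n + 1, k + 1 => qChoose p n k + p ^ (k + 1) * qChoose p n (k + 1)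

/-- The product `∏_{i < n} (1 - p ^ (i + 1))`. -/
def qFact {R : Type*} [CommRing R] (p : R) (n : ℕ) : R := ∏ i ∈ Finset.range n, (1 - p ^ (i + 1))

section qChoose

variable {R : Type*} [CommRing R] (p : R)

@[simp] theorem qChoose_zero_right (n : ℕ) : qChoose p n 0 = 1 := by cases n <;> rfl

theorem qChoose_succ_succ (n k : ℕ) :
    qChoose p (n + 1) (k + 1) = qChoose p n k + p ^ (k + 1) * qChoose p n (k + 1) := rfl

theorem qChoose_eq_zero {n k : ℕ} (h : n < k) : qChoose p n k = 0 := by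
  induction n generalizing k with
  | zero => cases k with
    | zero => omega
    | succ k => rfl
  | succ n ih => cases k with
    | zero => omega
    | succ k => rw [qChoose_succ_succ, ih (by omega), ih (by omega), mul_zero, add_zero]

theorem map_qChoose {S : Type*} [CommRing S] (f : R →+* S) (n k : ℕ) :
    f (qChoose p n k) = qChoose (f p) n k := by
  induction n generalizing k with
  | zero => cases k <;> simp [qChoose]
  | succ n ih => cases k with
    | zero => simp
    | succ k => simp [qChoose_succ_succ, ih]

theorem qFact_succ (n : ℕ) : qFact p (n + 1) = qFact p n * (1 - p ^ (n + 1)) :=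
  Finset.prod_range_succ _ _

@[simp] theorem qFact_zero : qFact p 0 = 1 := rfl

theorem qChoose_mul_qFact {n k : ℕ} (h : k ≤ n) :
    qChoose p n k * (qFact p (n - k) * qFact p k) = qFact p n := by
  induction n generalizing k with
  | zero =>
    obtain rfl : k = 0 := by omega
    simp
  | succ n ih => cases k with
    | zero => simp
    | succ k =>
      have h1 := ih (k := k) (by omega)
      rw [qChoose_succ_succ, Nat.add_sub_add_right, qFact_succ p k, qFact_succ p n]
      rcases eq_or_lt_of_le (Nat.le_of_succ_le_succ h) with rfl | hlt
      · rw [qChoose_eq_zero p (Nat.lt_succ_self k)]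
        linear_combination (1 - p ^ (k + 1)) * h1
      · have h2 := ih (k := k + 1) hlt
        obtain ⟨m, rfl⟩ := Nat.exists_eq_add_of_lt hlt
        rw [show k + m + 1 - k = m + 1 by omega] at h1 ⊢
        rw [show k + m + 1 - (k + 1) = m by omega, qFact_succ] at h2
        rw [qFact_succ p m] at h1 ⊢
        have h3 : p ^ (k + m + 1 + 1) = p ^ (k + 1) * p ^ (m + 1) := by rw [← pow_add]; congr 1; omega
        rw [h3]
        linear_combination (1 - p ^ (k + 1)) * h1 + p ^ (k + 1) * (1 - p ^ (m + 1)) * h2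

/-! ### Summation identities for Gaussian binomials -/

/-- The `q`-Pascal rule summed over `r`: the common induction step of the three identities that
follow. -/
theorem sum_qChoose_succ {M : Type*} [AddCommGroup M] [Module R M] (n : ℕ) (f : ℕ → M) :
    ∑ r ∈ Finset.range (n + 1 + 1), qChoose p (n + 1) r • f r =
      ∑ r ∈ Finset.range (n + 1), qChoose p n r • (p ^ r • f r + f (r + 1)) := by
  rw [Finset.sum_range_succ']
  simp only [qChoose_succ_succ, add_smul, smul_add, Finset.sum_add_distrib, qChoose_zero_right]
  have h := Finset.sum_range_succ' (fun r => qChoose p n r • p ^ r • f r) (n + 1)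
  rw [Finset.sum_range_succ, qChoose_eq_zero p (Nat.lt_succ_self n), zero_smul, add_zero] at h
  rw [h]
  simp only [qChoose_zero_right, pow_zero, one_smul, mul_smul]
  simp only [smul_comm (p ^ _) (qChoose p _ _)]
  abel

/-- The `q`-binomial theorem: the induction step splits off the factor `1 + y` and replaces `y` by
`y p`. -/
theorem sum_qChoose_mul_pow (n : ℕ) (y : R) :
    ∑ r ∈ Finset.range (n + 1), qChoose p n r * (p ^ (r.choose 2) * y ^ r) =
      ∏ i ∈ Finset.range n, (1 + y * p ^ i) := by
  induction n generalizing y with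
  | zero => simp
  | succ n ih =>
    have h := sum_qChoose_succ p n fun r => p ^ (r.choose 2) * y ^ r
    simp only [smul_eq_mul] at h
    rw [h, Finset.prod_range_succ']
    have h2 := ih (y * p)
    simp only [mul_assoc, ← pow_succ'] at h2
    rw [← h2, Finset.sum_mul]
    refine Finset.sum_congr rfl fun r _ => ?_
    rw [show (r + 1).choose 2 = r + r.choose 2 by simp [Nat.choose_succ_succ' r 1]]
    ring

/-- In the induction step neighbouring terms combine through `(1 - z p^r) + z p^r = 1` into the same
sum for `z p`. This is the weight identity for `(0, 2)`-splittings. -/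
theorem sum_qChoose_mul_prod_Ico (n : ℕ) (z : R) :
    ∑ r ∈ Finset.range (n + 1), qChoose p n r * (p ^ (r * (r - 1)) * z ^ r *
      ∏ i ∈ Finset.Ico r n, (1 - z * p ^ i)) = 1 := by
  induction n generalizing z with
  | zero => simp
  | succ n ih =>
    have h := sum_qChoose_succ p n fun r => p ^ (r * (r - 1)) * z ^ r *
      ∏ i ∈ Finset.Ico r (n + 1), (1 - z * p ^ i)
    simp only [smul_eq_mul] at h
    refine h.trans ((Finset.sum_congr rfl fun r hr => ?_).trans (ih (z * p)))
    rw [Finset.prod_eq_prod_Ico_succ_bot (by simpa using hr), Nat.add_sub_cancel]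
    have h2 : ∏ i ∈ Finset.Ico r n, (1 - z * p * p ^ i) =
        ∏ i ∈ Finset.Ico (r + 1) (n + 1), (1 - z * p ^ i) := by
      rw [← Finset.prod_Ico_add' (fun i => 1 - z * p ^ i) r n 1]
      refine Finset.prod_congr rfl fun i _ => by ring
    rw [h2]
    have h3 : (r + 1) * r = r * (r - 1) + r + r := by cases r <;> simp; ring
    rw [h3]
    ring

/-- The sum for `n + 1` is `1 - y` times the sum at `y p` plus `y` times the sum at `y`. This is the
weight identity for `(-1, -2)`-splittings. -/
theorem sum_qChoose_mul_prod_range (n : ℕ) (y : R) :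
    ∑ r ∈ Finset.range (n + 1), qChoose p n r * (y ^ r *
      ∏ j ∈ Finset.range (n - r), (1 - y * p ^ j)) = 1 := by
  induction n generalizing y with
  | zero => simp
  | succ n ih =>
    have h := sum_qChoose_succ p n fun r => y ^ r *
      ∏ j ∈ Finset.range (n + 1 - r), (1 - y * p ^ j)
    simp only [smul_eq_mul] at h
    have h3 : ∀ r ∈ Finset.range (n + 1), qChoose p n r * (p ^ r * (y ^ r *
        ∏ j ∈ Finset.range (n + 1 - r), (1 - y * p ^ j)) + y ^ (r + 1) *
          ∏ j ∈ Finset.range (n + 1 - (r + 1)), (1 - y * p ^ j)) =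
        (1 - y) * (qChoose p n r * ((y * p) ^ r *
          ∏ j ∈ Finset.range (n - r), (1 - y * p * p ^ j))) +
        y * (qChoose p n r * (y ^ r * ∏ j ∈ Finset.range (n - r), (1 - y * p ^ j))) := by
      intro r hr
      have hr' : r ≤ n := by simpa [Nat.lt_succ_iff] using hr
      rw [show n + 1 - r = n - r + 1 by omega, Finset.prod_range_succ', Nat.add_sub_add_right]
      have h2 : ∀ j, y * p ^ (j + 1) = y * p * p ^ j := fun j => by ring
      simp only [h2]
      ring
    rw [h, Finset.sum_congr rfl h3, Finset.sum_add_distrib, ← Finset.mul_sum, ← Finset.mul_sum,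
      ih, ih]
    ring

theorem choose_two_add (x y : ℕ) : (x + y).choose 2 = x.choose 2 + y.choose 2 + x * y := by
  induction y with
  | zero => simp
  | succ y ih =>
    rw [← add_assoc, Nat.choose_succ_succ' (x + y) 1, Nat.choose_succ_succ' y 1, ih]
    simp only [Nat.choose_one_right]
    ring

variable {α β : Type*} [DecidableEq α] [LinearOrder β] {σ : α → β}

/-- The interval is cut into consecutive blocks of lengths `D b`, arranged by decreasing `σ`; the
inner sum is the offset of block `b`. The element with the smallest `σ` is the last block. -/
theorem prod_range_sum_eq (hσ : σ.Injective) (s : Finset α) (D : α → ℕ) (f : ℕ → R) :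
    ∏ i ∈ Finset.range (∑ a ∈ s, D a), f i =
      ∏ b ∈ s, ∏ i ∈ Finset.range (D b), f (∑ a ∈ s with σ b < σ a, D a + i) := by
  induction s using Finset.induction_on_min_value σ with
  | empty => simp
  | insert c s hc hmin ih =>
    have hlt : ∀ x ∈ s, σ c < σ x := fun x hx =>
      lt_of_le_of_ne (hmin x hx) fun h => hc (hσ h ▸ hx)
    have h1 : (insert c s).filter (fun a => σ c < σ a) = s := by
      rw [Finset.filter_insert, if_neg (lt_irrefl _), Finset.filter_true_of_mem hlt]
    have h2 : ∀ b ∈ s, (insert c s).filter (fun a => σ b < σ a) = s.filter fun a => σ b < σ a :=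
      fun b hb => by rw [Finset.filter_insert, if_neg (hlt b hb).not_gt]
    rw [Finset.sum_insert hc, Finset.prod_insert hc, h1, add_comm, Finset.prod_range_add, ih,
      mul_comm]
    congr 1
    exact Finset.prod_congr rfl fun b hb => by rw [h2 b hb]

/-- A pair lies within one part or across two parts, and `σ` selects one order for each pair of
parts. -/
theorem choose_two_sum (hσ : σ.Injective) (s : Finset α) (r : α → ℕ) :
    (∑ a ∈ s, r a).choose 2 =
      ∑ b ∈ s, (r b).choose 2 + ∑ b ∈ s, ∑ a ∈ s with σ b < σ a, r a * r b := by
  induction s using Finset.induction_on_min_value σ with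
  | empty => simp
  | insert c s hc hmin ih =>
    have hlt : ∀ x ∈ s, σ c < σ x := fun x hx =>
      lt_of_le_of_ne (hmin x hx) fun h => hc (hσ h ▸ hx)
    have h1 : (insert c s).filter (fun a => σ c < σ a) = s := by
      rw [Finset.filter_insert, if_neg (lt_irrefl _), Finset.filter_true_of_mem hlt]
    have h2 : ∀ b ∈ s, (insert c s).filter (fun a => σ b < σ a) = s.filter fun a => σ b < σ a :=
      fun b hb => by rw [Finset.filter_insert, if_neg (hlt b hb).not_gt]
    have h3 : ∑ b ∈ s, ∑ a ∈ insert c s with σ b < σ a, r a * r b =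
        ∑ b ∈ s, ∑ a ∈ s with σ b < σ a, r a * r b :=
      Finset.sum_congr rfl fun b hb => by rw [h2 b hb]
    rw [Finset.sum_insert hc, Finset.sum_insert hc, Finset.sum_insert hc, h1, h3, choose_two_add,
      ih, ← Finset.sum_mul]
    ring

/-- The number of pairs, one from the part `D a - r a` and one from the part `r b`, with
`σ b < σ a`. -/
def crossInv [Fintype α] (σ : α → β) (D r : α → ℕ) : ℕ :=
  ∑ b, ∑ a with σ b < σ a, (D a - r a) * r b

/-- The `q`-Vandermonde identity for an arbitrary number of parts and an arbitrary order of the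
parts, tested against a function `f`. -/
theorem sum_prod_qChoose [Fintype α] (hσ : σ.Injective) (hp : IsUnit p) {M : Type*}
    [AddCommGroup M] [Module R M] (D : α → ℕ) (f : ℕ → M) :
    ∑ r ∈ Fintype.piFinset fun a => Finset.range (D a + 1),
      ((∏ a, qChoose p (D a) (r a)) * p ^ crossInv σ D r) • f (∑ a, r a) =
    ∑ k ∈ Finset.range (∑ a, D a + 1), qChoose p (∑ a, D a) k • f k := by
  obtain ⟨u, rfl⟩ := hp
  -- This functional removes the factor `p ^ (k.choose 2)` of the `q`-binomial theorem and puts `f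
  -- k` in place of `X ^ k`; here `p` must be invertible.
  let L : Polynomial R →ₗ[R] M := Polynomial.lsum fun k =>
    LinearMap.toSpanSingleton R M (((u⁻¹ : Rˣ) : R) ^ (k.choose 2) • f k)
  have hL : ∀ (c : R) (k : ℕ),
      L (Polynomial.C (c * (u : R) ^ (k.choose 2)) * Polynomial.X ^ k) = c • f k := by
    intro c k
    have hu : (u : R) ^ (k.choose 2) * ((u⁻¹ : Rˣ) : R) ^ (k.choose 2) = 1 := by
      rw [← mul_pow, Units.mul_inv, one_pow]
    rw [Polynomial.C_mul_X_pow_eq_monomial]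
    simp only [L, Polynomial.lsum_apply]
    rw [Polynomial.sum_monomial_index _ _ (by simp), LinearMap.toSpanSingleton_apply, smul_smul,
      mul_assoc, hu, mul_one]
  -- The product `∏ (1 + X p^i)` is expanded in two ways, as a whole and block by block in the order
  -- given by `σ`.
  have h1 := sum_qChoose_mul_pow (Polynomial.C (u : R)) (∑ a, D a) Polynomial.X
  rw [prod_range_sum_eq hσ] at h1
  have h2 : ∀ b : α, ∏ i ∈ Finset.range (D b), (1 + (Polynomial.X : Polynomial R) *
      Polynomial.C (u : R) ^ (∑ a with σ b < σ a, D a + i)) =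
      ∑ r ∈ Finset.range (D b + 1), Polynomial.C (qChoose (u : R) (D b) r *
        (u : R) ^ (r.choose 2 + (∑ a with σ b < σ a, D a) * r)) * Polynomial.X ^ r := by
    intro b
    simp only [pow_add, ← mul_assoc]
    rw [← sum_qChoose_mul_pow]
    refine Finset.sum_congr rfl fun r _ => ?_
    rw [← map_qChoose]
    simp only [map_mul, map_pow]
    ring
  rw [Finset.prod_congr rfl fun b _ => h2 b, Finset.prod_univ_sum] at h1
  have h3 := congrArg L h1
  rw [map_sum, map_sum] at h3
  have h4 : ∀ k, qChoose (Polynomial.C (u : R)) (∑ a, D a) k * (Polynomial.C (u : R) ^ k.choose 2 *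
      Polynomial.X ^ k) = Polynomial.C (qChoose (u : R) (∑ a, D a) k * (u : R) ^ (k.choose 2)) *
        Polynomial.X ^ k := by
    intro k
    rw [← map_qChoose]
    simp only [map_mul, map_pow]
    ring
  rw [Finset.sum_congr rfl fun k _ => by rw [h4 k, hL]] at h3
  rw [h3]
  refine Finset.sum_congr rfl fun r hr => ?_
  rw [Fintype.mem_piFinset] at hr
  rw [Finset.prod_mul_distrib, ← map_prod, Finset.prod_mul_distrib, Finset.prod_pow_eq_pow_sum,
    Finset.prod_pow_eq_pow_sum, ← hL]
  congr 3
  rw [mul_assoc, ← pow_add]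
  congr 2
  -- The block offsets contribute `D a * r b`. Writing `D a = (D a - r a) + r a` separates the
  -- inversions from the cross terms of `(∑ r).choose 2`.
  rw [choose_two_sum hσ, Finset.sum_add_distrib, crossInv, add_left_comm, ← Finset.sum_add_distrib]
  congr 1
  refine Finset.sum_congr rfl fun b _ => ?_
  rw [← Finset.sum_add_distrib, Finset.sum_mul]
  refine Finset.sum_congr rfl fun a _ => ?_
  have : r a ≤ D a := by simpa [Nat.lt_succ_iff] using hr a
  rw [← add_mul]
  congr 1
  omega

end qChoose

/-! ### Powers of `q` and Pochhammer symbols -/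

section Powers

theorem qPow_zero : qPow 0 = 1 := rfl

theorem qPow_add (a b : ℤ) : qPow (a + b) = qPow a * qPow b := by
  simp [qPow, HahnSeries.single_mul_single]

theorem qPow_pow (a : ℤ) (n : ℕ) : qPow a ^ n = qPow (n * a) := by
  induction n with
  | zero => simp [qPow_zero]
  | succ n ih => rw [pow_succ, ih, ← qPow_add]; congr 1; push_cast; ring

theorem isUnit_qPow (a : ℤ) : IsUnit (qPow a) :=
  IsUnit.of_mul_eq_one (qPow (-a)) (by rw [← qPow_add, add_neg_cancel, qPow_zero])

theorem negQPow_eq (a : ℤ) : negQPow a = (a.negOnePow : ℤ) • qPow a := by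
  ext t
  rw [negQPow, coeff_smul_qPow, HahnSeries.coeff_single]
  split_ifs <;> rfl

theorem negQPow_add (a b : ℤ) : negQPow (a + b) = negQPow a * negQPow b := by
  simp [negQPow, HahnSeries.single_mul_single, Int.negOnePow_add]

theorem negQPow_two_mul (a : ℤ) : negQPow (2 * a) = qPow (2 * a) := by
  rw [negQPow_eq, Int.negOnePow_even _ (even_two_mul a)]; simp

theorem negQPow_zero : negQPow 0 = 1 := by simp [negQPow]

theorem qPoch_eq_qFact (n : ℕ) : qPoch n = qFact (qPow 2) n := by
  refine Finset.prod_congr rfl fun k _ => ?_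
  rw [← qPow_add, qPow_pow]
  congr 2; push_cast; ring

theorem inverse_qPoch_mul {n k : ℕ} (h : k ≤ n) :
    Ring.inverse (qPoch (n - k)) * Ring.inverse (qPoch k)
      = qChoose (qPow 2) n k * Ring.inverse (qPoch n) := by
  have h1 := qChoose_mul_qFact (qPow 2) h
  simp only [← qPoch_eq_qFact] at h1
  have h2 := Ring.inverse_mul_cancel _ (isUnit_qPoch n)
  have h3 := Ring.mul_inverse_cancel _ (isUnit_qPoch (n - k))
  have h4 := Ring.mul_inverse_cancel _ (isUnit_qPoch k)
  refine (isUnit_qPoch n).mul_right_cancel ?_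
  rw [mul_assoc (qChoose _ _ _) _ (qPoch n), h2, mul_one]
  calc _ = qChoose (qPow 2) n k * (qPoch (n - k) * Ring.inverse (qPoch (n - k))) *
        (qPoch k * Ring.inverse (qPoch k)) := by rw [← h1]; ring
    _ = _ := by rw [h3, h4, mul_one, mul_one]

theorem inverse_qPoch (n : ℕ) :
    Ring.inverse (qPoch n) = (1 - qPow (2 * (n + 1))) * Ring.inverse (qPoch (n + 1)) := by
  have h1 : qPoch (n + 1) = qPoch n * (1 - qPow (2 * (n + 1))) := by
    rw [qPoch_eq_qFact, qPoch_eq_qFact, qFact_succ, qPow_pow]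
    congr 3; push_cast; ring
  refine (isUnit_qPoch n).mul_left_cancel ?_
  rw [← mul_assoc, ← h1, Ring.mul_inverse_cancel _ (isUnit_qPoch n),
    Ring.mul_inverse_cancel _ (isUnit_qPoch (n + 1))]

theorem inverse_qPoch_zero : Ring.inverse (qPoch 0) = 1 := by simp [qPoch]

/-- The Pochhammer symbol has constant term `1`, so its order is at most `0`; orders add up to `0`
for a unit and its inverse. -/
theorem coeff_inverse_qPoch (n : ℕ) : ∀ t < 0, (Ring.inverse (qPoch n)).coeff t = 0 := by
  have h : (∀ t < 0, (qPoch n).coeff t = 0) ∧ (qPoch n).coeff 0 = 1 := by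
    rw [qPoch_eq_qFact]
    induction n with
    | zero => exact ⟨fun t ht => by simp [HahnSeries.coeff_one, ht.ne], by simp⟩
    | succ n ih =>
      have h1 : ∀ t, (qFact (qPow 2) (n + 1)).coeff t = (qFact (qPow 2) n).coeff t -
          (qFact (qPow 2) n).coeff (t - ((n + 1 : ℕ) : ℤ) * 2) := by
        intro t
        rw [qFact_succ, mul_sub, mul_one, HahnSeries.coeff_sub, qPow_pow,
          qPow.eq_def (_ * 2), HahnSeries.coeff_mul_single, mul_one]
      refine ⟨fun t ht => ?_, ?_⟩
      · rw [h1, ih.1 t ht, ih.1 _ (by push_cast; omega), sub_zero]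
      · rw [h1, ih.2, ih.1 _ (by push_cast; omega), sub_zero]
  have h0 : qPoch n ≠ 0 := (isUnit_qPoch n).ne_zero
  have h1 := Ring.mul_inverse_cancel _ (isUnit_qPoch n)
  have h2 : Ring.inverse (qPoch n) ≠ 0 := by
    intro h2; rw [h2, mul_zero] at h1; exact zero_ne_one h1
  have h3 := HahnSeries.order_mul h0 h2
  rw [h1, HahnSeries.order_one] at h3
  have h4 : (qPoch n).order ≤ 0 := HahnSeries.order_le_of_coeff_ne_zero (by rw [h.2]; exact one_ne_zero)
  intro t ht
  exact HahnSeries.coeff_eq_zero_of_lt_order (by omega)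

end Powers

/-! ### The extra node -/

section Extra

variable {V : Type*}

/-- The monomial `x₀ ^ r` of the extra node with coefficient `c`. -/
noncomputable def extraMonomial (V : Type*) (r : ℕ) (c : LaurentSeries ℤ) : QSeries (Option V) :=
  MvPowerSeries.monomial (Finsupp.single none r) c

theorem extraMonomial_mul (r s : ℕ) (c d : LaurentSeries ℤ) :
    extraMonomial V r c * extraMonomial V s d = extraMonomial V (r + s) (c * d) := by
  rw [extraMonomial, extraMonomial, MvPowerSeries.monomial_mul_monomial, ← Finsupp.single_add]
  rfl

theorem extraMonomial_zero_one : extraMonomial V 0 1 = 1 := by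
  simp [extraMonomial]

theorem extraMonomial_pow (r n : ℕ) (c : LaurentSeries ℤ) :
    extraMonomial V r c ^ n = extraMonomial V (n * r) (c ^ n) := by
  induction n with
  | zero => simp [extraMonomial_zero_one]
  | succ n ih => rw [pow_succ, ih, extraMonomial_mul, pow_succ]; congr 1; ring

theorem qChoose_extraMonomial (n k : ℕ) (c : LaurentSeries ℤ) :
    qChoose (extraMonomial V 0 c) n k = extraMonomial V 0 (qChoose c n k) := by
  have h : ∀ x, extraMonomial V 0 x = MvPowerSeries.C x := fun x => by
    rw [extraMonomial, Finsupp.single_zero, MvPowerSeries.monomial_zero_eq_C_apply]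
  rw [h, h, map_qChoose]

theorem val_dilogFactor_extraDim (s : ℤ) :
    (dilogFactor (extraDim V) s : QSeries (Option V)) = 1 - extraMonomial V 1 (qPow s) := rfl

/-- The compatibility of a weight `W n`, attached to the dimension vectors whose total dimension at
the split nodes is `n`, with one `(k, l)`-splitting with factor `κ = q ^ c x₀`. -/
def IsSplitWeight (k l c : ℤ) (W : ℕ → QSeries (Option V)) : Prop :=
  ∀ N, ∑ r ∈ Finset.range (N + 1), extraMonomial V r (qChoose (qPow 2) N r *
    (negQPow (l * r ^ 2 + 2 * k * (N - r) * r) * qPow (r * c))) * W r = W N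

/-- Division by `W N` leaves the ratios `W r / W N`, which for both weights are finite products over
`r ≤ i < N`. -/
theorem isSplitWeight_of_forall {k l c : ℤ} (W : ℕ → (QSeries (Option V))ˣ)
    (h : ∀ N, ∑ r ∈ Finset.range (N + 1), extraMonomial V r (qChoose (qPow 2) N r *
    (negQPow (l * r ^ 2 + 2 * k * (N - r) * r) * qPow (r * c))) *
      ((W r * (W N)⁻¹ : (QSeries (Option V))ˣ) : QSeries (Option V)) = 1) :
    IsSplitWeight k l c fun N => (W N : QSeries (Option V)) := by
  intro N
  have := congrArg (· * (W N : QSeries (Option V))) (h N)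
  simp only [Finset.sum_mul, one_mul] at this
  refine Eq.trans (Finset.sum_congr rfl fun r _ => ?_) this
  rw [mul_assoc _ (Units.val _), ← Units.val_mul, inv_mul_cancel_right]

/-- The weight for `(0, 2)`-splittings. -/
noncomputable def unlinkWeight (V : Type*) (N : ℕ) : (QSeries (Option V))ˣ :=
  ∏ i ∈ Finset.range N, (dilogFactor (extraDim V) (2 * i + 1))⁻¹

/-- The weight for `(-1, -2)`-splittings. -/
noncomputable def linkWeight (V : Type*) (N : ℕ) : (QSeries (Option V))ˣ :=
  ∏ i ∈ Finset.range N, (dilogFactor (extraDim V) (2 * (-(i : ℤ) - 1)))⁻¹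

theorem prod_range_inv_mul_inv {G : Type*} [CommGroup G] (f : ℕ → G) {r N : ℕ} (h : r ≤ N) :
    (∏ i ∈ Finset.range r, (f i)⁻¹) * (∏ i ∈ Finset.range N, (f i)⁻¹)⁻¹ =
      ∏ i ∈ Finset.Ico r N, f i := by
  rw [Finset.prod_inv_distrib, Finset.prod_inv_distrib, inv_inv, ← Finset.prod_range_mul_prod_Ico f h,
    inv_mul_cancel_left]

/-- The substitution is `p = q²`, `z = q x₀`: the exponent `2r² - r` of `q` equals `2r(r - 1) + r`.
-/
theorem isSplitWeight_unlinkWeight :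
    IsSplitWeight 0 2 (-1) fun N => (unlinkWeight V N : QSeries (Option V)) := by
  refine isSplitWeight_of_forall _ fun N => ?_
  rw [← sum_qChoose_mul_prod_Ico (extraMonomial V 0 (qPow 2)) N (extraMonomial V 1 (qPow 1))]
  refine Finset.sum_congr rfl fun r hr => ?_
  have hr' : r ≤ N := by simpa [Nat.lt_succ_iff] using hr
  rw [unlinkWeight, unlinkWeight, prod_range_inv_mul_inv _ hr', Units.coe_prod]
  simp only [val_dilogFactor_extraDim, extraMonomial_pow, extraMonomial_mul, qChoose_extraMonomial,
    ← mul_assoc]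
  simp only [mul_zero, add_zero, zero_add, mul_one, qPow_pow, mul_assoc, ← qPow_add]
  congr 1
  · congr 2
    rw [show (2 * (r : ℤ) ^ 2 + 0 * ((N - r) * r)) = 2 * r ^ 2 by ring, negQPow_two_mul,
      ← qPow_add]
    congr 1
    cases r with
    | zero => simp
    | succ r => push_cast; simp; ring
  · refine Finset.prod_congr rfl fun i _ => ?_
    congr 3
    ring

/-- The substitution is `p = q²`, `y = q^{-2N} x₀`: the exponent `-2r² - 2(N - r)r` is `-2Nr`, and
the factors match after reversing their order. -/
theorem isSplitWeight_linkWeight :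
    IsSplitWeight (-1) (-2) 0 fun N => (linkWeight V N : QSeries (Option V)) := by
  refine isSplitWeight_of_forall _ fun N => ?_
  rw [← sum_qChoose_mul_prod_range (extraMonomial V 0 (qPow 2)) N
    (extraMonomial V 1 (qPow (2 * (-(N : ℤ)))))]
  refine Finset.sum_congr rfl fun r hr => ?_
  have hr' : r ≤ N := by simpa [Nat.lt_succ_iff] using hr
  rw [linkWeight, linkWeight, prod_range_inv_mul_inv _ hr', Units.coe_prod,
    Finset.prod_Ico_eq_prod_range, ← Finset.prod_range_reflect]
  simp only [val_dilogFactor_extraDim, extraMonomial_pow, extraMonomial_mul, qChoose_extraMonomial,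
    ← mul_assoc]
  simp only [mul_zero, add_zero, zero_add, mul_one, qPow_pow, mul_assoc, ← qPow_add, qPow_zero]
  congr 1
  · congr 2
    rw [show ((-2 : ℤ) * r ^ 2 + 2 * (-1 * ((N - r) * r))) = 2 * (-(N * r)) by ring, negQPow_two_mul]
    congr 1
    ring
  · refine Finset.prod_congr rfl fun i hi => ?_
    have hi' := Finset.mem_range.1 hi
    congr 3
    omega

open Classical in
/-- The series `∑_j (-q) ^ (m j²) q ^ (2 z j) x₀ ^ j / (q²; q²)_j`. -/
noncomputable def extraSeries (V : Type*) (m z : ℤ) : QSeries (Option V) := fun e =>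
  if Finsupp.single none (e none) = e then
    negQPow (m * (e none : ℤ) ^ 2) * qPow (2 * z * e none) * Ring.inverse (qPoch (e none)) else 0

open Classical in
theorem coeff_extraSeries (m z : ℤ) (e : Option V →₀ ℕ) :
    MvPowerSeries.coeff e (extraSeries V m z) = if Finsupp.single none (e none) = e then
      negQPow (m * (e none : ℤ) ^ 2) * qPow (2 * z * e none) * Ring.inverse (qPoch (e none))
    else 0 := rfl

theorem coeff_one_sub_extraMonomial_mul (s : ℤ) (f : QSeries (Option V)) (e : Option V →₀ ℕ) :
    MvPowerSeries.coeff e ((1 - extraMonomial V 1 (qPow s)) * f) = MvPowerSeries.coeff e f -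
      if 1 ≤ e none then qPow s * MvPowerSeries.coeff (e - Finsupp.single none 1) f else 0 := by
  classical
  rw [sub_mul, one_mul, map_sub, extraMonomial, MvPowerSeries.coeff_monomial_mul]
  simp only [Finsupp.single_le_iff]

/-- The hypothesis is the comparison of the coefficients of `x₀ ^ (j + 1)` after `1 / (q²;
q²)_{j+1}` has been cancelled. -/
theorem one_sub_mul_extraSeries {m z m' z' s : ℤ} (h : ∀ j : ℕ,
    negQPow (m' * ((j : ℤ) + 1) ^ 2) * qPow (2 * z' * (j + 1)) =
      negQPow (m * ((j : ℤ) + 1) ^ 2) * qPow (2 * z * (j + 1)) -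
      (1 - qPow (2 * (j + 1))) * qPow s * (negQPow (m * (j : ℤ) ^ 2) * qPow (2 * z * j))) :
    extraSeries V m' z' = (1 - extraMonomial V 1 (qPow s)) * extraSeries V m z := by
  ext1 e
  rw [coeff_one_sub_extraMonomial_mul, coeff_extraSeries, coeff_extraSeries, coeff_extraSeries]
  by_cases he : Finsupp.single none (e none) = e
  · obtain ⟨j, hj⟩ : ∃ j, e none = j := ⟨_, rfl⟩
    rw [hj] at he
    subst he
    cases j with
    | zero => simp
    | succ j =>
      have h1 : (Finsupp.single none (j + 1) - Finsupp.single none 1 : Option V →₀ ℕ)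
          = Finsupp.single none j := by
        rw [← Finsupp.single_tsub, Nat.add_sub_cancel]
      simp only [h1, Finsupp.single_eq_same, if_true]
      rw [if_pos (by omega), inverse_qPoch j]
      push_cast
      rw [h]
      ring
  · have h1 : 1 ≤ e none → ¬ Finsupp.single none ((e - Finsupp.single none 1 : Option V →₀ ℕ) none)
        = e - Finsupp.single none 1 := by
      intro h1 h2
      refine he ?_
      have h3 : Finsupp.single none 1 ≤ e := by simpa using h1
      rw [← tsub_add_cancel_of_le h3, ← h2, Finsupp.add_apply, Finsupp.single_eq_same,
        Finsupp.single_eq_same, ← Finsupp.single_add]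
    rw [if_neg he, if_neg he]
    split_ifs with h2 h3
    · exact absurd h3 (h1 h2)
    · simp
    · simp

/-- The functional equation `E(x) = (1 - q x) E(q² x)` at `x = q^{2z} x₀`. -/
theorem extraSeries_one (z : ℤ) : extraSeries V 1 z =
    (dilogFactor (extraDim V) (2 * z + 1) ^ (1 : ℤ) : (QSeries (Option V))ˣ) *
      extraSeries V 1 (z + 1) := by
  rw [zpow_one, val_dilogFactor_extraDim]
  refine one_sub_mul_extraSeries fun j => ?_
  have h : negQPow (1 * ((j : ℤ) + 1) ^ 2) =
      -(qPow (2 * j + 1) * negQPow (1 * (j : ℤ) ^ 2)) := by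
    rw [show (1 * ((j : ℤ) + 1) ^ 2) = 2 * j + (1 + 1 * j ^ 2) by ring, negQPow_add,
      negQPow_two_mul, negQPow_add, qPow_add]
    have : negQPow 1 = - qPow 1 := by rw [negQPow_eq]; simp
    rw [this]; ring
  rw [h]
  have h1 : qPow (2 * (z + 1) * (j + 1)) = qPow (2 * z * (j + 1)) * qPow (2 * (j + 1)) := by
    rw [← qPow_add]; ring_nf
  have h2 : qPow (2 * z + 1) * qPow (2 * (z + 1) * j) = qPow (2 * z * (j + 1)) * qPow (2 * j + 1) := by
    rw [← qPow_add, ← qPow_add]; ring_nf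
  rw [h1]
  linear_combination (1 - qPow (2 * (j + 1))) * negQPow (1 * (j : ℤ) ^ 2) * h2

/-- The functional equation `E(x) = (1 - x)⁻¹ E(q² x)` at `x = q^{2z} x₀`. -/
theorem extraSeries_zero (z : ℤ) : extraSeries V 0 z =
    (dilogFactor (extraDim V) (2 * z + 0) ^ (-1 : ℤ) : (QSeries (Option V))ˣ) *
      extraSeries V 0 (z + 1) := by
  rw [zpow_neg_one, Units.eq_inv_mul_iff_mul_eq, val_dilogFactor_extraDim, eq_comm]
  refine one_sub_mul_extraSeries fun j => ?_
  simp only [zero_mul, negQPow_zero, one_mul, add_zero]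
  have h1 : qPow (2 * (z + 1) * (j + 1)) = qPow (2 * z * (j + 1)) * qPow (2 * (j + 1)) := by
    rw [← qPow_add]; ring_nf
  have h2 : qPow (2 * z) * qPow (2 * z * j) = qPow (2 * z * (j + 1)) := by
    rw [← qPow_add]; ring_nf
  rw [h1]
  linear_combination (1 - qPow (2 * (j + 1))) * h2

/-- The functional equation applied `N` times shows that the weight is `E(q^{2N} x₀) / E(x₀)`. -/
theorem unlinkWeight_mul_extraSeries (N : ℕ) :
    unlinkWeight V N * extraSeries V 1 0 = extraSeries V 1 (1 * N) := by
  induction N with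
  | zero => simp [unlinkWeight]
  | succ N ih =>
    rw [unlinkWeight, Finset.prod_range_succ, mul_comm (Finset.prod _ _), Units.val_mul, mul_assoc,
      ← unlinkWeight, ih, Units.inv_mul_eq_iff_eq_mul, one_mul, extraSeries_one, zpow_one]
    simp

/-- The functional equation is used from `z = -N` up to `0`, whence the negative exponents of `q` in
the weight. -/
theorem linkWeight_mul_extraSeries (N : ℕ) :
    linkWeight V N * extraSeries V 0 0 = extraSeries V 0 (-1 * N) := by
  induction N with
  | zero => simp [linkWeight]
  | succ N ih =>
    rw [linkWeight, Finset.prod_range_succ, mul_comm (Finset.prod _ _), Units.val_mul, mul_assoc,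
      ← linkWeight, ih, extraSeries_zero (-1 * ((N + 1 : ℕ) : ℤ)), zpow_neg_one]
    push_cast
    ring_nf

/-- Each term with `j ≥ 1` carries `q^{2Nj}`, and its other factors have no negative powers of `q`
as `m ≥ 0`. Thus the series tends to `1` as `N` grows. -/
theorem extraSeries_sub_one_mem {m : ℤ} (hm : 0 ≤ m) (a N : ℕ) (e₀ : Option V →₀ ℕ) :
    extraSeries V m N - 1 ∈ slopeFiltration a e₀ N := by
  classical
  intro e _ t ht
  rw [map_sub, coeff_extraSeries, MvPowerSeries.coeff_one, HahnSeries.coeff_sub]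
  by_cases he : Finsupp.single none (e none) = e
  · obtain ⟨j, hj⟩ : ∃ j, e none = j := ⟨_, rfl⟩
    rw [hj] at he
    subst he
    cases j with
    | zero => simp [negQPow_zero, qPow_zero, inverse_qPoch_zero]
    | succ j =>
      have h1 : (Finsupp.single none (j + 1) : Option V →₀ ℕ) ≠ 0 := by simp
      rw [if_neg h1, HahnSeries.coeff_zero, sub_zero]
      simp only [Finsupp.single_eq_same, if_true]
      have h2 : 0 ≤ m * ((j + 1 : ℕ) : ℤ) ^ 2 := by positivity
      have h3 : (0 : ℤ) ≤ a * (Finsupp.single none (j + 1) : Option V →₀ ℕ).degree := by positivity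
      have h4 : (N : ℤ) ≤ 2 * N * ((j + 1 : ℕ) : ℤ) := by push_cast; nlinarith
      rw [negQPow_eq, qPow, qPow, smul_mul_assoc, smul_mul_assoc, HahnSeries.single_mul_single,
        HahnSeries.coeff_smul, HahnSeries.coeff_single_mul, coeff_inverse_qPoch _ _ (by omega)]
      simp
  · have h1 : e ≠ 0 := by rintro rfl; simp at he
    rw [if_neg he, if_neg h1]
    simp

/-- Iterating the functional equation gives `N` dilogarithm factors times a remainder that tends to
`1`. -/
theorem hasDilogProd_singleState {m s ω : ℤ} (hm : 0 ≤ m)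
    (h : ∀ z, extraSeries V m z =
      (dilogFactor (extraDim V) (2 * z + s) ^ ω : (QSeries (Option V))ˣ) *
        extraSeries V m (z + 1)) :
    HasDilogProd (singleState V s ω) (extraSeries V m 0) := by
  classical
  obtain ⟨P, hP⟩ := exists_hasDilogProd (singleState V s ω)
  suffices hPY : P = extraSeries V m 0 by rwa [← hPY]
  ext e t
  obtain ⟨a, ha⟩ := exists_slopeBound (singleState V s ω) e
  set T := (t + a * e.degree + 1).toNat
  obtain ⟨F₀, hF₀⟩ := eventually_atTop.1 (hP.eventually_sub_mem ha T)
  -- This `N` exceeds every `k` occurring in `F₀`, so the partial product over `F₀ ∪ G` is exactly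
  -- the product over `k < N`; it also exceeds `T`, which makes the remainder negligible.
  set N := T + (F₀.sup fun p => p.2.2) + 1
  set G := (Finset.range N).image fun k : ℕ => (extraDim V, s, k)
  have hprod : partialProd (singleState V s ω) (F₀ ∪ G) =
      ∏ k ∈ Finset.range N, dilogFactor (extraDim V) (2 * (k : ℤ) + s) ^ ω := by
    rw [partialProd, ← Finset.prod_subset Finset.subset_union_right]
    · rw [Finset.prod_image (by intro x _ y _ hxy; exact (Prod.ext_iff.1 (Prod.ext_iff.1 hxy).2).2)]
      simp [singleState]
    · rintro ⟨d, s', k⟩ hp hpG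
      have : (singleState V s ω d).coeff s' = 0 := by
        rw [singleState]
        split_ifs with hd
        · rw [HahnSeries.coeff_single_of_ne]
          rintro rfl
          refine hpG (Finset.mem_image.2 ⟨k, Finset.mem_range.2 ?_, by rw [hd]⟩)
          have hpF : (d, s', k) ∈ F₀ := (Finset.mem_union.1 hp).resolve_right hpG
          have : k ≤ F₀.sup fun p => p.2.2 := Finset.le_sup (f := fun p => p.2.2) hpF
          omega
        · rfl
      simp only [this, zpow_zero]
  have hY : ∀ n : ℕ, extraSeries V m 0 =
      ((∏ k ∈ Finset.range n, dilogFactor (extraDim V) (2 * (k : ℤ) + s) ^ ω :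
        (QSeries (Option V))ˣ) : QSeries (Option V)) * extraSeries V m n := by
    intro n
    induction n with
    | zero => simp
    | succ n ih =>
      rw [ih, h n, Finset.prod_range_succ, Units.val_mul, mul_assoc]
      push_cast
      rfl
  have h1 := hF₀ (F₀ ∪ G) Finset.subset_union_left
  have h2 : (partialProd (singleState V s ω) (F₀ ∪ G) : QSeries (Option V)) *
      (extraSeries V m N - 1) ∈ slopeFiltration a e T := by
    have := mul_mem_slopeFiltration (val_mem_slopeFiltration
      (partialProd_mem_slopeUnits_zero ha (F₀ ∪ G))) (extraSeries_sub_one_mem hm a N e)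
    refine slopeFiltration_anti ?_ this
    push_cast [N]
    omega
  have h3 : P - extraSeries V m 0 ∈ slopeFiltration a e T := by
    have h4 := sub_mem (neg_mem h1) h2
    rw [hY N, ← hprod]
    convert h4 using 1
    ring
  have h5 := h3 e le_rfl t (by omega)
  rw [map_sub, HahnSeries.coeff_sub] at h5
  linarith

end Extra

/-! ### Quadratic forms and terms for finitely many nodes -/

namespace SymQuiver

variable {ι τ : Type*} (Q : SymQuiver ι τ)

theorem quadForm_eq_sum [Fintype ι] (d : ι →₀ ℕ) :
    Q.quadForm d = ∑ i, ∑ j, Q.C i j * (d i : ℤ) * (d j : ℤ) := by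
  rw [quadForm, Finsupp.sum_fintype _ _ (by simp)]
  refine Finset.sum_congr rfl fun i _ => ?_
  rw [Finsupp.sum_fintype _ _ (by simp)]

theorem monomial_eq_sum [Fintype ι] (d : ι →₀ ℕ) : Q.monomial d = ∑ i, d i • Q.param i :=
  Finsupp.sum_fintype _ _ (by simp)

theorem prod_inverse_qPoch [Fintype ι] (d : ι →₀ ℕ) :
    (d.prod fun _ a => Ring.inverse (qPoch a)) = ∏ i, Ring.inverse (qPoch (d i)) :=
  Finsupp.prod_fintype _ _ fun _ => inverse_qPoch_zero

theorem quadForm_embDomain {κ : Type*} (Q' : SymQuiver κ τ) (f : ι ↪ κ)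
    (hC : ∀ i j, Q'.C (f i) (f j) = Q.C i j) (d : ι →₀ ℕ) :
    Q'.quadForm (d.embDomain f) = Q.quadForm d := by
  simp only [quadForm, Finsupp.sum_embDomain, hC]

theorem monomial_embDomain {κ : Type*} (Q' : SymQuiver κ τ) (f : ι ↪ κ)
    (hp : ∀ i, Q'.param (f i) = Q.param i) (d : ι →₀ ℕ) :
    Q'.monomial (d.embDomain f) = Q.monomial d := by
  simp only [monomial, Finsupp.sum_embDomain, hp]

theorem term_embDomain {κ : Type*} (Q' : SymQuiver κ τ) (f : ι ↪ κ)
    (hC : ∀ i j, Q'.C (f i) (f j) = Q.C i j) (hp : ∀ i, Q'.param (f i) = Q.param i) (d : ι →₀ ℕ) :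
    Q'.term (d.embDomain f) = Q.term d := by
  simp only [term, quadForm_embDomain Q Q' f hC, monomial_embDomain Q Q' f hp,
    Finsupp.prod_embDomain]

end SymQuiver

/-! ### One splitting -/

theorem Fintype.prod_eq_mul_of_isCompl {α β γ M : Type*} [Fintype α] [Fintype β] [Fintype γ]
    [CommMonoid M] {f : α ↪ γ} {g : β ↪ γ} (h : IsCompl (Set.range f) (Set.range g)) (F : γ → M) :
    ∏ i, F i = (∏ a, F (f a)) * ∏ b, F (g b) := by
  classical
  have hu : (Finset.univ : Finset γ) = Finset.univ.map f ∪ Finset.univ.map g := by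
    ext i
    have := h.sup_eq_top.ge (Set.mem_univ i)
    simpa using this
  have hd : Disjoint (Finset.univ.map f) (Finset.univ.map g) := by
    rw [← Finset.disjoint_coe]
    simpa using h.disjoint
  rw [hu, Finset.prod_union hd, Finset.prod_map, Finset.prod_map]

theorem Fintype.sum_eq_add_of_isCompl {α β γ M : Type*} [Fintype α] [Fintype β] [Fintype γ]
    [AddCommMonoid M] {f : α ↪ γ} {g : β ↪ γ} (h : IsCompl (Set.range f) (Set.range g))
    (F : γ → M) : ∑ i, F i = (∑ a, F (f a)) + ∑ b, F (g b) :=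
  Fintype.prod_eq_mul_of_isCompl (M := Multiplicative M) h F

section Splitting

variable {ι ι' : Type*} {n : ℕ} {sel : Fin n ↪ ι} {old : ι ↪ ι'}
  {new : Fin n ↪ ι'}

/-- The vector on the original nodes that has the entries `r` at the selected nodes. -/
def selVec [DecidableEq ι] (sel : Fin n ↪ ι) (r : Fin n → ℕ) (v : ι) : ℕ :=
  ∑ a, if sel a = v then r a else 0

theorem selVec_sel [DecidableEq ι] (r : Fin n → ℕ) (a : Fin n) : selVec sel r (sel a) = r a := by
  simp [selVec]

theorem selVec_of_notMem [DecidableEq ι] (r : Fin n → ℕ) {v : ι} (hv : v ∉ Set.range sel) :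
    selVec sel r v = 0 :=
  Finset.sum_eq_zero fun a _ => if_neg fun h => hv ⟨a, h⟩

theorem sum_selVec_smul [Fintype ι] [DecidableEq ι] {M : Type*} [AddCommMonoid M] (r : Fin n → ℕ) (f : ι → M) :
    ∑ v, selVec sel r v • f v = ∑ a, r a • f (sel a) := by
  simp only [selVec, Finset.sum_smul, ite_smul, zero_smul]
  rw [Finset.sum_comm]
  simp

theorem sum_selVec_mul [Fintype ι] [DecidableEq ι] (r : Fin n → ℕ) (f : ι → ℤ) :
    ∑ v, f v * (selVec sel r v : ℤ) = ∑ a, f (sel a) * (r a : ℤ) := by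
  have := sum_selVec_smul (sel := sel) r f
  simpa [mul_comm] using this

variable {τ : Type*} {k l : ℤ} {σ : Equiv.Perm (Fin n)} {h : ι → ℤ} {κ : ℤ × (τ →₀ ℕ)}
  {Q : SymQuiver ι τ} {Q' : SymQuiver ι' τ}

namespace IsSplitting

/-- Only the entries at split nodes differ from those of `Q`: each by `k`, and by one more when `σ b
< σ a`. -/
theorem sum_old_new [Fintype ι] (S : IsSplitting k l σ h κ Q Q' sel old new)
    (hh : ∀ s, s ∉ Set.range sel → h s = 0) (x : ι → ℕ) (b : Fin n) :
    ∑ v, Q'.C (old v) (new b) * (x v : ℤ) = ∑ v, Q.C v (sel b) * (x v : ℤ) +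
      k * ∑ a, (x (sel a) : ℤ) + ∑ a with σ b < σ a, (x (sel a) : ℤ) := by
  classical
  have h1 : ∑ v, Q'.C (old v) (new b) * (x v : ℤ) - ∑ v, Q.C v (sel b) * (x v : ℤ) =
      ∑ a, (Q'.C (old (sel a)) (new b) - Q.C (sel a) (sel b)) * (x (sel a) : ℤ) := by
    rw [← Finset.sum_sub_distrib, ← Finset.sum_map Finset.univ sel
      fun v => (Q'.C (old v) (new b) - Q.C v (sel b)) * (x v : ℤ)]
    rw [← Finset.sum_subset (Finset.subset_univ (Finset.univ.map sel))]
    · exact Finset.sum_congr rfl fun v _ => by ring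
    · intro v _ hv
      have hv' : v ∉ Set.range sel := by simpa using hv
      rw [S.spectator v hv', hh v hv']
      ring
  have h2 : ∀ a, (Q'.C (old (sel a)) (new b) - Q.C (sel a) (sel b)) * (x (sel a) : ℤ) =
      k * (x (sel a) : ℤ) + if σ b < σ a then (x (sel a) : ℤ) else 0 := by
    intro a
    rcases lt_trichotomy (σ b) (σ a) with hlt | heq | hgt
    · rw [S.old_new_of_gt a b hlt, if_pos hlt]; ring
    · obtain rfl := σ.injective heq
      rw [S.old_new_self, if_neg (lt_irrefl _)]; ring
    · rw [S.old_new_of_lt a b hgt, if_neg hgt.not_gt]; ring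
  rw [Finset.sum_congr rfl fun a _ => h2 a, Finset.sum_add_distrib, ← Finset.mul_sum,
    ← Finset.sum_filter] at h1
  linarith

/-- With `d = x + r`, where `x` lives on the old nodes and `r` on the copies, both forms expand
bilinearly. The difference consists of `l` on the copies, `k` between old and new, and the extra
arrows prescribed by `σ`, each counted twice by symmetry. -/
theorem quadForm_eq [Fintype ι] [Fintype ι'] [DecidableEq ι] (S : IsSplitting k l σ h κ Q Q' sel old new)
    (hh : ∀ s, s ∉ Set.range sel → h s = 0) {d : ι →₀ ℕ}
    {d' : ι' →₀ ℕ} (hd : ∀ v, d v = d' (old v) + selVec sel (fun a => d' (new a)) v) :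
    Q'.quadForm d' = Q.quadForm d + (l * (∑ a, d' (new a) : ℕ) ^ 2 +
      2 * k * ((∑ a, d (sel a) : ℕ) - (∑ a, d' (new a) : ℕ)) * (∑ a, d' (new a) : ℕ)) +
      2 * (crossInv σ (fun a => d (sel a)) fun a => d' (new a) : ℕ) := by
  set r : Fin n → ℕ := fun a => d' (new a)
  set x : ι → ℕ := fun v => d' (old v)
  have hx : ∀ a, d (sel a) = x (sel a) + r a := fun a => by rw [hd, selVec_sel]
  have h1 : Q'.quadForm d' = ∑ v, ∑ w, Q.C v w * (x v : ℤ) * (x w : ℤ) +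
      2 * ∑ b, (r b : ℤ) * ∑ v, Q'.C (old v) (new b) * (x v : ℤ) +
      ∑ a, ∑ b, Q'.C (new a) (new b) * (r a : ℤ) * (r b : ℤ) := by
    rw [SymQuiver.quadForm_eq_sum, Fintype.sum_eq_add_of_isCompl S.nodes]
    simp only [Fintype.sum_eq_add_of_isCompl S.nodes, Finset.sum_add_distrib, S.old_old]
    have e1 : ∑ v, ∑ b, Q'.C (old v) (new b) * (d' (old v) : ℤ) * (d' (new b) : ℤ) =
        ∑ b, (r b : ℤ) * ∑ v, Q'.C (old v) (new b) * (x v : ℤ) := by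
      rw [Finset.sum_comm]
      simp only [Finset.mul_sum]
      exact Finset.sum_congr rfl fun b _ => Finset.sum_congr rfl fun v _ => by ring
    have e2 : ∑ b, ∑ v, Q'.C (new b) (old v) * (d' (new b) : ℤ) * (d' (old v) : ℤ) =
        ∑ b, (r b : ℤ) * ∑ v, Q'.C (old v) (new b) * (x v : ℤ) := by
      simp only [Finset.mul_sum]
      exact Finset.sum_congr rfl fun b _ => Finset.sum_congr rfl fun v _ => by
        rw [Q'.symm (new b)]; ring
    rw [e1, e2]
    ring
  have h2 : Q.quadForm d = ∑ v, ∑ w, Q.C v w * (x v : ℤ) * (x w : ℤ) +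
      2 * ∑ b, (r b : ℤ) * ∑ v, Q.C v (sel b) * (x v : ℤ) +
      ∑ a, ∑ b, Q.C (sel a) (sel b) * (r a : ℤ) * (r b : ℤ) := by
    have e0 : Q.quadForm d = ∑ v, ∑ w, Q.C v w * (x v : ℤ) * (x w : ℤ) +
        ∑ v, ∑ w, (Q.C v w * (x v : ℤ)) * (selVec sel r w : ℤ) +
        ∑ v, ∑ w, Q.C v w * (selVec sel r v : ℤ) * (x w : ℤ) +
        ∑ v, ∑ w, (Q.C v w * (selVec sel r v : ℤ)) * (selVec sel r w : ℤ) := by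
      rw [SymQuiver.quadForm_eq_sum]
      simp only [← Finset.sum_add_distrib]
      refine Finset.sum_congr rfl fun v _ => Finset.sum_congr rfl fun w _ => ?_
      rw [hd v, hd w]
      push_cast
      ring
    have e1 : ∑ v, ∑ w, (Q.C v w * (x v : ℤ)) * (selVec sel r w : ℤ) =
        ∑ b, (r b : ℤ) * ∑ v, Q.C v (sel b) * (x v : ℤ) := by
      simp only [sum_selVec_mul, Finset.mul_sum]
      rw [Finset.sum_comm]
      exact Finset.sum_congr rfl fun b _ => Finset.sum_congr rfl fun v _ => by ring
    have e2 : ∑ v, ∑ w, Q.C v w * (selVec sel r v : ℤ) * (x w : ℤ) =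
        ∑ v, ∑ w, (Q.C v w * (x v : ℤ)) * (selVec sel r w : ℤ) := by
      rw [Finset.sum_comm]
      exact Finset.sum_congr rfl fun b _ => Finset.sum_congr rfl fun v _ => by
        rw [Q.symm v b]; ring
    have e3 : ∑ v, ∑ w, (Q.C v w * (selVec sel r v : ℤ)) * (selVec sel r w : ℤ) =
        ∑ a, ∑ b, Q.C (sel a) (sel b) * (r a : ℤ) * (r b : ℤ) := by
      simp only [sum_selVec_mul]
      rw [Finset.sum_comm]
      simp only [← Finset.sum_mul, sum_selVec_mul]
      simp only [Finset.sum_mul]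
      exact Finset.sum_comm
    rw [e0, e2, e1, e3]
    ring
  have h3 : ∑ a, ∑ b, Q'.C (new a) (new b) * (r a : ℤ) * (r b : ℤ) =
      ∑ a, ∑ b, Q.C (sel a) (sel b) * (r a : ℤ) * (r b : ℤ) + l * (∑ a, (r a : ℤ)) ^ 2 := by
    rw [sq, Finset.sum_mul_sum]
    simp only [S.new_new, Finset.mul_sum, ← Finset.sum_add_distrib]
    exact Finset.sum_congr rfl fun b _ => Finset.sum_congr rfl fun v _ => by ring
  have h4 : ((crossInv σ (fun a => d (sel a)) r : ℕ) : ℤ) =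
      ∑ b, (r b : ℤ) * ∑ a with σ b < σ a, (x (sel a) : ℤ) := by
    rw [crossInv]
    push_cast
    refine Finset.sum_congr rfl fun b _ => ?_
    rw [Finset.mul_sum]
    refine Finset.sum_congr rfl fun a _ => ?_
    rw [hx, Nat.add_sub_cancel]
    ring
  have h5 : ((∑ a, d (sel a) : ℕ) : ℤ) - ((∑ a, r a : ℕ) : ℤ) = ∑ a, (x (sel a) : ℤ) := by
    simp only [hx, Finset.sum_add_distrib]
    push_cast
    ring
  rw [h5, h4, h1, h2, h3]
  simp only [S.sum_old_new hh x]
  simp only [mul_add, Finset.sum_add_distrib, ← Finset.sum_mul]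
  push_cast
  ring

theorem monomial_eq [Fintype ι] [Fintype ι'] [DecidableEq ι] (S : IsSplitting k l σ h κ Q Q' sel old new)
    {d : ι →₀ ℕ}
    {d' : ι' →₀ ℕ} (hd : ∀ v, d v = d' (old v) + selVec sel (fun a => d' (new a)) v) :
    Q'.monomial d' = Q.monomial d + (∑ a, d' (new a)) • κ := by
  rw [SymQuiver.monomial_eq_sum, SymQuiver.monomial_eq_sum,
    Fintype.sum_eq_add_of_isCompl S.nodes]
  simp only [hd, add_smul, Finset.sum_add_distrib, sum_selVec_smul, S.param_old, S.param_new,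
    smul_add, Finset.sum_smul, add_assoc]

theorem prod_inverse_qPoch_eq [Fintype ι] [Fintype ι'] [DecidableEq ι] (S : IsSplitting k l σ h κ Q Q' sel old new)
    {d : ι →₀ ℕ}
    {d' : ι' →₀ ℕ} (hd : ∀ v, d v = d' (old v) + selVec sel (fun a => d' (new a)) v) :
    (d'.prod fun _ a => Ring.inverse (qPoch a)) =
      (d.prod fun _ a => Ring.inverse (qPoch a)) *
        ∏ a, qChoose (qPow 2) (d (sel a)) (d' (new a)) := by
  have hx : ∀ a, d (sel a) = d' (old (sel a)) + d' (new a) := fun a => by rw [hd, selVec_sel]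
  rw [SymQuiver.prod_inverse_qPoch, SymQuiver.prod_inverse_qPoch,
    Fintype.prod_eq_mul_of_isCompl S.nodes,
    ← Finset.prod_mul_prod_compl (Finset.univ.map sel) fun v => Ring.inverse (qPoch (d' (old v))),
    ← Finset.prod_mul_prod_compl (Finset.univ.map sel) fun v => Ring.inverse (qPoch (d v)),
    Finset.prod_map, Finset.prod_map]
  have h1 : ∏ v ∈ (Finset.univ.map sel)ᶜ, Ring.inverse (qPoch (d' (old v))) =
      ∏ v ∈ (Finset.univ.map sel)ᶜ, Ring.inverse (qPoch (d v)) := by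
    refine Finset.prod_congr rfl fun v hv => ?_
    rw [hd v, selVec_of_notMem _ (by simpa using hv), add_zero]
  have h2 : (∏ a, Ring.inverse (qPoch (d' (old (sel a))))) * ∏ a, Ring.inverse (qPoch (d' (new a))) =
      (∏ a, Ring.inverse (qPoch (d (sel a)))) *
        ∏ a, qChoose (qPow 2) (d (sel a)) (d' (new a)) := by
    rw [← Finset.prod_mul_distrib, ← Finset.prod_mul_distrib]
    refine Finset.prod_congr rfl fun a _ => ?_
    have := inverse_qPoch_mul (n := d (sel a)) (k := d' (new a)) (by rw [hx]; omega)
    rw [mul_comm (Ring.inverse (qPoch (d (sel a)))), ← this, hx, Nat.add_sub_cancel]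
  rw [h1, mul_right_comm, h2]
  ring

/-- The extra arrows prescribed by `σ` produce exactly the inversion exponent of the `q`-Vandermonde
identity for `p = q²`; the last factor sees only the totals. -/
theorem term_eq [Fintype ι] [Fintype ι'] [DecidableEq ι] (S : IsSplitting k l σ h κ Q Q' sel old new)
    (hh : ∀ s, s ∉ Set.range sel → h s = 0) {d : ι →₀ ℕ}
    {d' : ι' →₀ ℕ} (hd : ∀ v, d v = d' (old v) + selVec sel (fun a => d' (new a)) v) :
    Q'.term d' = Q.term d * (((∏ a, qChoose (qPow 2) (d (sel a)) (d' (new a))) *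
      qPow 2 ^ crossInv σ (fun a => d (sel a)) fun a => d' (new a)) *
      (negQPow (l * (∑ a, d' (new a) : ℕ) ^ 2 +
      2 * k * ((∑ a, d (sel a) : ℕ) - (∑ a, d' (new a) : ℕ)) * (∑ a, d' (new a) : ℕ)) *
      qPow ((∑ a, d' (new a) : ℕ) * κ.1))) := by
  rw [SymQuiver.term, SymQuiver.term, S.quadForm_eq hh hd, S.monomial_eq hd,
    S.prod_inverse_qPoch_eq hd, negQPow_add, negQPow_add, Prod.fst_add, qPow_add,
    negQPow_two_mul, qPow_pow, mul_comm ((_ : ℕ) : ℤ) 2]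
  simp only [Prod.smul_fst, nsmul_eq_mul]
  ring

end IsSplitting

end Splitting

/-! ### Invariance of the weighted generating series -/

section SplitSeries

variable {V : Type*} {ι ι' : Type*} [Fintype ι] [Fintype ι'] {n : ℕ} {sel : Fin n ↪ ι}
  {old : ι ↪ ι'} {new : Fin n ↪ ι'}

/-- The part of the generating series with `m` nodes, in which the dimension vector `d` has the weight
`W (∑ a, d (sel a))`. -/
noncomputable def weightedSeries [DecidableEq ι] (Q : SymQuiver ι (Option V)) (sel : Fin n ↪ ι)
    (W : ℕ → QSeries (Option V)) (m : ℕ) : QSeries (Option V) :=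
  ∑ d ∈ Finset.finsuppAntidiag Finset.univ m,
    MvPowerSeries.monomial (Q.monomial d).2 (Q.term d) * W (∑ a, d (sel a))

/-- Merging each copy with its original, while recording the part `r` on the copies, is a bijection
that preserves the total dimension `m`. -/
theorem sum_merge [DecidableEq ι] [DecidableEq ι'] (hc : IsCompl (Set.range old) (Set.range new))
    {M : Type*} [AddCommMonoid M] (m : ℕ) (F : (ι →₀ ℕ) → (Fin n → ℕ) → M) (G : (ι' →₀ ℕ) → M)
    (hFG : ∀ (d : ι →₀ ℕ) (d' : ι' →₀ ℕ),
      (∀ v, d v = d' (old v) + selVec sel (fun a => d' (new a)) v) →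
        F d (fun a => d' (new a)) = G d') :
    ∑ d ∈ Finset.finsuppAntidiag Finset.univ m,
      ∑ r ∈ Fintype.piFinset (fun a => Finset.range (d (sel a) + 1)), F d r =
    ∑ d' ∈ Finset.finsuppAntidiag Finset.univ m, G d' := by
  have hbij : Function.Bijective (Sum.elim old new : ι ⊕ Fin n → ι') := by
    constructor
    · refine Function.Injective.sumElim old.injective new.injective fun a b hab => ?_
      exact Set.disjoint_left.1 hc.disjoint ⟨a, rfl⟩ ⟨b, hab.symm⟩
    · rw [← Set.range_eq_univ, Set.Sum.elim_range]
      exact hc.sup_eq_top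
  let e : ι ⊕ Fin n ≃ ι' := Equiv.ofBijective _ hbij
  have he1 : ∀ v, e.symm (old v) = Sum.inl v := fun v => e.symm_apply_apply (Sum.inl v)
  have he2 : ∀ a, e.symm (new a) = Sum.inr a := fun a => e.symm_apply_apply (Sum.inr a)
  let split : (ι →₀ ℕ) → (Fin n → ℕ) → (ι' →₀ ℕ) := fun d r => Finsupp.equivFunOnFinite.symm
    fun i => Sum.elim (fun v => d v - selVec sel r v) r (e.symm i)
  let merge : (ι' →₀ ℕ) → (ι →₀ ℕ) := fun d' => Finsupp.equivFunOnFinite.symm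
    fun v => d' (old v) + selVec sel (fun a => d' (new a)) v
  have hs1 : ∀ d r v, split d r (old v) = d v - selVec sel r v := fun d r v => by
    simp [split, he1]
  have hs2 : ∀ d r a, split d r (new a) = r a := fun d r a => by simp [split, he2]
  have hm : ∀ d' v, merge d' v = d' (old v) + selVec sel (fun a => d' (new a)) v := fun _ _ => rfl
  have hle : ∀ (d : ι →₀ ℕ) r, r ∈ Fintype.piFinset (fun a => Finset.range (d (sel a) + 1)) →
      ∀ v, selVec sel r v ≤ d v := by
    intro d r hr v
    by_cases hv : v ∈ Set.range sel
    · obtain ⟨a, rfl⟩ := hv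
      rw [selVec_sel]
      have := Fintype.mem_piFinset.1 hr a
      simpa [Nat.lt_succ_iff] using this
    · rw [selVec_of_notMem _ hv]
      exact Nat.zero_le _
  have hsum : ∀ d', ∑ v, merge d' v = ∑ i, d' i := by
    intro d'
    simp only [hm, Finset.sum_add_distrib]
    have := sum_selVec_smul (sel := sel) (fun a => d' (new a)) (fun _ => 1)
    simp only [smul_eq_mul, mul_one] at this
    rw [this, Fintype.sum_eq_add_of_isCompl hc]
  have hms : ∀ (d : ι →₀ ℕ) r, r ∈ Fintype.piFinset (fun a => Finset.range (d (sel a) + 1)) →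
      merge (split d r) = d := by
    intro d r hr
    ext v
    rw [hm, hs1]
    simp only [hs2]
    exact Nat.sub_add_cancel (hle d r hr v)
  rw [Finset.sum_sigma']
  refine Finset.sum_bij' (fun p _ => split p.1 p.2) (fun d' _ => ⟨merge d', fun a => d' (new a)⟩)
    ?_ ?_ ?_ ?_ ?_
  · rintro ⟨d, r⟩ hp
    obtain ⟨hd, hr⟩ := Finset.mem_sigma.1 hp
    rw [Finset.mem_finsuppAntidiag] at hd ⊢
    refine ⟨?_, Finset.subset_univ _⟩
    rw [← hd.1, ← hsum, hms d r hr]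
  · intro d' hd'
    rw [Finset.mem_finsuppAntidiag] at hd'
    refine Finset.mem_sigma.2 ⟨?_, ?_⟩
    · rw [Finset.mem_finsuppAntidiag]
      exact ⟨(hsum d').trans hd'.1, Finset.subset_univ _⟩
    · rw [Fintype.mem_piFinset]
      intro a
      simp only [hm, selVec_sel, Finset.mem_range]
      omega
  · rintro ⟨d, r⟩ hp
    obtain ⟨hd, hr⟩ := Finset.mem_sigma.1 hp
    simp only [hms d r hr, hs2]
  · intro d' _
    ext i
    obtain ⟨j, rfl⟩ := e.surjective i
    rcases j with v | a
    · change split _ _ (old v) = d' (old v)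
      rw [hs1, hm, Nat.add_sub_cancel]
    · change split _ _ (new a) = d' (new a)
      rw [hs2]
  · rintro ⟨d, r⟩ hp
    obtain ⟨hd, hr⟩ := Finset.mem_sigma.1 hp
    rw [← hFG d (split d r) fun v => by rw [← hm, hms d r hr]]
    simp only [hs2]

/-- A splitting does not change the weighted generating series. -/
theorem IsSplitting.weightedSeries_eq [DecidableEq ι] [DecidableEq ι'] {k l c : ℤ}
    {σ : Equiv.Perm (Fin n)} {h : ι → ℤ} {Q : SymQuiver ι (Option V)} {Q' : SymQuiver ι' (Option V)}
    (S : IsSplitting k l σ h (c, Finsupp.single none 1) Q Q' sel old new)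
    (hh : ∀ s, s ∉ Set.range sel → h s = 0) {W : ℕ → QSeries (Option V)}
    (hW : IsSplitWeight k l c W) (m : ℕ) :
    weightedSeries Q' new W m = weightedSeries Q sel W m := by
  set wt : ℕ → ℕ → LaurentSeries ℤ := fun N r =>
    negQPow (l * (r : ℤ) ^ 2 + 2 * k * ((N : ℤ) - r) * r) * qPow (r * c)
  symm
  rw [weightedSeries, weightedSeries, ← sum_merge S.nodes m (fun d r =>
    MvPowerSeries.monomial (Q.monomial d).2 (Q.term d) *
      (((∏ a, qChoose (qPow 2) (d (sel a)) (r a)) * qPow 2 ^ crossInv σ (fun a => d (sel a)) r) •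
        (extraMonomial V (∑ a, r a) (wt (∑ a, d (sel a)) (∑ a, r a)) * W (∑ a, r a))))]
  · refine Finset.sum_congr rfl fun d _ => ?_
    -- The weight depends on `r` only through its total, so the `q`-Vandermonde identity eliminates
    -- the permutation.
    rw [← Finset.mul_sum, sum_prod_qChoose (qPow 2) σ.injective (isUnit_qPow 2)
      (fun a => d (sel a)) (fun r => extraMonomial V r (wt (∑ a, d (sel a)) r) * W r)]
    congr 1
    rw [← hW]
    refine Finset.sum_congr rfl fun r _ => ?_
    rw [← smul_mul_assoc, extraMonomial, extraMonomial, ← map_smul, smul_eq_mul]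
  · intro d d' hd
    rw [S.term_eq hh hd, S.monomial_eq hd, ← smul_mul_assoc, extraMonomial, ← map_smul, smul_eq_mul,
      ← mul_assoc, MvPowerSeries.monomial_mul_monomial]
    congr 3
    simp

end SplitSeries

/-! ### Degrees of dimension vectors -/

section NodeDegree

variable {V ι : Type*}

/-- The total degree in the variables `x_v` other than the variable of the extra node. -/
noncomputable def nodeDegree (V : Type*) : (Option V →₀ ℕ) →+ ℕ where
  toFun e := e.some.degree
  map_zero' := by simp
  map_add' e e' := by simp

theorem nodeDegree_apply (e : Option V →₀ ℕ) : nodeDegree V e = e.some.degree := rfl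

@[simp] theorem nodeDegree_single_none (j : ℕ) : nodeDegree V (Finsupp.single none j) = 0 := by
  simp [nodeDegree_apply]

@[simp] theorem nodeDegree_single_some (v : V) (j : ℕ) :
    nodeDegree V (Finsupp.single (some v) j) = j := by
  simp [nodeDegree_apply]

namespace SymQuiver

theorem monomial_snd {τ : Type*} (Q : SymQuiver ι τ) (d : ι →₀ ℕ) :
    (Q.monomial d).2 = ∑ i ∈ d.support, d i • (Q.param i).2 := by
  rw [monomial, Finsupp.sum, Prod.snd_sum]
  rfl

theorem param_le_monomial {τ : Type*} (Q : SymQuiver ι τ) {d : ι →₀ ℕ} {i : ι} (h : d i ≠ 0) :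
    (Q.param i).2 ≤ (Q.monomial d).2 := by
  rw [monomial_snd]
  refine le_trans ?_ (Finset.single_le_sum (f := fun i => d i • (Q.param i).2)
    (fun _ _ => zero_le) (Finsupp.mem_support_iff.2 h))
  intro t
  simpa using Nat.le_mul_of_pos_left _ (Nat.pos_of_ne_zero h)

theorem nodeDegree_monomial (Q : SymQuiver ι (Option V))
    (h : ∀ i, nodeDegree V (Q.param i).2 = 1) (d : ι →₀ ℕ) :
    nodeDegree V (Q.monomial d).2 = d.degree := by
  rw [monomial_snd, map_sum, Finsupp.degree_apply]
  simp [h]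

theorem coeff_motivicSeries {τ : Type*} (Q : SymQuiver ι τ) (e : τ →₀ ℕ) :
    MvPowerSeries.coeff e Q.motivicSeries = ∑ᶠ d ∈ Q.dimVectors e, Q.term d := rfl

-- When each parameter has node degree `1`, the total dimension can be read off from `e`, which
-- leaves finitely many candidates.
open Classical in
theorem dimVectors_eq [Fintype ι] (Q : SymQuiver ι (Option V))
    (h : ∀ i, nodeDegree V (Q.param i).2 = 1) (e : Option V →₀ ℕ) :
    Q.dimVectors e = ((Finset.finsuppAntidiag Finset.univ (nodeDegree V e)).filter
      fun d => (Q.monomial d).2 = e : Finset (ι →₀ ℕ)) := by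
  ext d
  simp only [dimVectors, Set.mem_ofPred_eq, Finset.coe_filter, Finset.mem_finsuppAntidiag]
  refine ⟨fun hd => ⟨⟨?_, Finset.subset_univ _⟩, hd⟩, fun hd => hd.2⟩
  rw [← hd, Q.nodeDegree_monomial h, Finsupp.degree_eq_sum]

/-- A vector that is nonzero at a selected node has too high a power of `x₀` to contribute; for all
others the weight is `W 0 = 1`. -/
theorem coeff_weightedSeries [Fintype ι] [DecidableEq ι] (Q : SymQuiver ι (Option V))
    (h : ∀ i, nodeDegree V (Q.param i).2 = 1) {n : ℕ} (sel : Fin n ↪ ι)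
    {W : ℕ → QSeries (Option V)} (hW : W 0 = 1) {e : Option V →₀ ℕ}
    (he : ∀ a, e none < (Q.param (sel a)).2 none) :
    MvPowerSeries.coeff e (weightedSeries Q sel W (nodeDegree V e))
      = MvPowerSeries.coeff e Q.motivicSeries := by
  classical
  rw [coeff_motivicSeries, Q.dimVectors_eq h, finsum_mem_coe_finset, Finset.sum_filter,
    weightedSeries, map_sum]
  refine Finset.sum_congr (by congr!) fun d _ => ?_
  by_cases hd : ∃ a, d (sel a) ≠ 0
  · obtain ⟨a, ha⟩ := hd
    have h1 : ¬ (Q.monomial d).2 ≤ e := fun hle =>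
      ((he a).trans_le ((Q.param_le_monomial ha none).trans (hle none))).false
    rw [MvPowerSeries.coeff_monomial_mul, if_neg h1, if_neg fun h2 => h1 h2.le]
  · push Not at hd
    simp only [hd, Finset.sum_const_zero, hW, mul_one, MvPowerSeries.coeff_monomial]
    simp only [eq_comm]

theorem monomial_of_param {τ : Type*} (Q : SymQuiver ι τ) (f : ι ↪ τ)
    (h : ∀ i, Q.param i = (0, Finsupp.single (f i) 1)) (d : ι →₀ ℕ) :
    Q.monomial d = (0, d.embDomain f) := by
  have h1 : (d.embDomain f).sum (fun i a => Finsupp.single i a) = d.embDomain f :=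
    Finsupp.sum_single _
  rw [Finsupp.sum_embDomain] at h1
  refine Prod.ext ?_ ?_
  · rw [monomial, Finsupp.sum, Prod.fst_sum]
    simp [h]
  · rw [monomial_snd]
    refine Eq.trans ?_ h1
    simp [h, Finsupp.sum]

theorem dimVectors_embDomain {τ : Type*} (Q : SymQuiver ι τ) (f : ι ↪ τ)
    (h : ∀ i, Q.param i = (0, Finsupp.single (f i) 1)) (d : ι →₀ ℕ) :
    Q.dimVectors (d.embDomain f) = {d} := by
  ext d'
  simp [dimVectors, Q.monomial_of_param f h, (Finsupp.embDomain_injective f).eq_iff]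

theorem coeff_motivicSeries_embDomain {τ : Type*} (Q : SymQuiver ι τ) (f : ι ↪ τ)
    (h : ∀ i, Q.param i = (0, Finsupp.single (f i) 1)) (d : ι →₀ ℕ) :
    MvPowerSeries.coeff (d.embDomain f) Q.motivicSeries = Q.term d := by
  rw [coeff_motivicSeries, Q.dimVectors_embDomain f h, finsum_mem_singleton]

theorem dimVectors_eq_empty {τ : Type*} (Q : SymQuiver ι τ) (f : ι ↪ τ)
    (h : ∀ i, Q.param i = (0, Finsupp.single (f i) 1)) {e : τ →₀ ℕ}
    (he : e ∉ Set.range (Finsupp.embDomain f)) : Q.dimVectors e = ∅ := by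
  ext d
  simp only [dimVectors, Set.mem_ofPred_eq, Set.mem_empty_iff_false, iff_false,
    Q.monomial_of_param f h]
  exact fun hd => he ⟨d, hd⟩

theorem isLocallyFinite_of_param {τ : Type*} (Q : SymQuiver ι τ) (f : ι ↪ τ)
    (h : ∀ i, Q.param i = (0, Finsupp.single (f i) 1)) : Q.IsLocallyFinite := by
  intro e
  by_cases he : e ∈ Set.range (Finsupp.embDomain f)
  · obtain ⟨d, rfl⟩ := he
    rw [Q.dimVectors_embDomain f h]
    exact Set.finite_singleton _
  · rw [Q.dimVectors_eq_empty f h he]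
    exact Set.finite_empty

theorem augment_param {n : ℕ} (Q : SymQuiver V (Option V)) (hQ : Q.HasFreeParams)
    (sel : Fin n ↪ V) (m z : ℤ) (i : Option V) :
    (Q.augment sel m z).param i = (0, Finsupp.single (Function.Embedding.refl _ i) 1) := by
  cases i with
  | none => rfl
  | some v => exact hQ v

/-- The extra node interacts with the others only through the total dimension at the selected nodes,
which amounts to rescaling `x₀` by a power of `q²`. -/
theorem term_augment [Finite V] {n : ℕ} (Q : SymQuiver V (Option V)) (hQ : Q.HasFreeParams)
    (sel : Fin n ↪ V) (m z : ℤ) (e : Option V →₀ ℕ) :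
    (Q.augment sel m z).term e = Q.term e.some * (negQPow (m * (e none : ℤ) ^ 2) *
      qPow (2 * (z * (∑ a, e.some (sel a) : ℕ)) * e none) * Ring.inverse (qPoch (e none))) := by
  classical
  have := Fintype.ofFinite V
  have h0 : ∀ x : V → ℤ, ∑ v, (if v ∈ Set.range sel then z else 0) * x v =
      z * ∑ a, x (sel a) := by
    intro x
    rw [Finset.mul_sum, ← Finset.sum_map Finset.univ sel fun v => z * x v]
    simp only [ite_mul, zero_mul]
    rw [← Finset.sum_filter]
    exact Finset.sum_congr (by ext; simp) fun _ _ => rfl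
  have h1 : (Q.augment sel m z).quadForm e = Q.quadForm e.some + (m * (e none : ℤ) ^ 2 +
      2 * ((z * (∑ a, e.some (sel a) : ℕ)) * e none)) := by
    rw [quadForm_eq_sum, quadForm_eq_sum]
    simp only [Fintype.sum_option, augment, Finsupp.some_apply, Finset.sum_add_distrib]
    have h2 : ∑ v, (if v ∈ Set.range sel then z else 0) * (e none : ℤ) * (e (some v) : ℤ) =
        z * ∑ a, (e (some (sel a)) : ℤ) * e none := by
      rw [← h0 fun v => (e (some v) : ℤ) * e none]
      exact Finset.sum_congr rfl fun _ _ => by ring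
    have h3 : ∑ v, (if v ∈ Set.range sel then z else 0) * (e (some v) : ℤ) * (e none : ℤ) =
        z * ∑ a, (e (some (sel a)) : ℤ) * e none := by
      rw [← h0 fun v => (e (some v) : ℤ) * e none]
      exact Finset.sum_congr rfl fun _ _ => by ring
    rw [h2, h3, ← Finset.sum_mul]
    push_cast
    ring
  rw [term, term, h1, monomial_of_param _ _ (Q.augment_param hQ sel m z),
    monomial_of_param Q Function.Embedding.some hQ, prod_inverse_qPoch, prod_inverse_qPoch,
    Fintype.prod_option, negQPow_add, negQPow_add, negQPow_two_mul, qPow_zero]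
  simp only [Finsupp.some_apply, mul_assoc, one_mul]
  ring

theorem motivicSeries_extraNode {n : ℕ} (Q : SymQuiver V (Option V))
    (sel : Fin n ↪ V) (m z : ℤ) (f : Unit ↪ Option V) (hf : ∀ u, f u = none) :
    ((Q.augment sel m z).subquiver f).IsLocallyFinite ∧
      ((Q.augment sel m z).subquiver f).motivicSeries = extraSeries V m 0 := by
  have hp : ∀ u, ((Q.augment sel m z).subquiver f).param u = (0, Finsupp.single (f u) 1) := by
    intro u
    simp only [subquiver, hf]
    rfl
  refine ⟨isLocallyFinite_of_param _ f hp, ?_⟩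
  ext1 e
  rw [coeff_extraSeries]
  split_ifs with he
  · obtain ⟨j, hj⟩ : ∃ j, e none = j := ⟨_, rfl⟩
    rw [hj] at he ⊢
    subst he
    have h1 : (Finsupp.single none j : Option V →₀ ℕ) =
        Finsupp.embDomain f (Finsupp.single () j) := by
      rw [Finsupp.embDomain_single, hf]
    rw [h1, coeff_motivicSeries_embDomain _ f hp, term, monomial_of_param _ f hp,
      prod_inverse_qPoch, quadForm_eq_sum]
    simp [subquiver, hf, augment, qPow_zero, sq, mul_assoc]
  · rw [coeff_motivicSeries, dimVectors_eq_empty _ f hp, finsum_mem_empty]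
    rintro ⟨d, rfl⟩
    refine he ?_
    obtain ⟨j, rfl⟩ : ∃ j, d = Finsupp.single () j := ⟨d (), by ext; simp⟩
    rw [Finsupp.embDomain_single, hf]
    simp

end SymQuiver

end NodeDegree

/-! ### Growth by splitting -/

namespace SplittingGrowth

variable {k l c : ℤ} {n : ℕ} {V : ℕ → Type*} {Q : ∀ i, SymQuiver (V i) (Option (V 0))}

theorem eq_incl_or_eq_sel (G : SplittingGrowth k l n (c, Finsupp.single none 1) Q) {i : ℕ} (v : V (i + 1)) :
    (∃ u, G.incl i u = v) ∨ ∃ a, G.sel (i + 1) a = v :=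
  (G.split i).nodes.sup_eq_top.ge (Set.mem_univ v)

theorem finite (G : SplittingGrowth k l n (c, Finsupp.single none 1) Q)
    [Finite (V 0)] (i : ℕ) : Finite (V i) := by
  induction i with
  | zero => infer_instance
  | succ i ih =>
    refine Set.finite_univ_iff.1 (((Set.finite_range (G.incl i)).union
      (Set.finite_range (G.sel (i + 1)))).subset fun v _ => G.eq_incl_or_eq_sel v)

/-- Each step contributes one factor `x₀`; this makes the growing quivers converge. -/
theorem param_sel (G : SplittingGrowth k l n (c, Finsupp.single none 1) Q)
    (hQ : (Q 0).HasFreeParams) (i : ℕ) (a : Fin n) :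
    ((Q i).param (G.sel i a)).2 none = i := by
  induction i with
  | zero => simp [hQ _]
  | succ i ih => simp [(G.split i).param_new, ih]

theorem nodeDegree_param (G : SplittingGrowth k l n (c, Finsupp.single none 1) Q)
    (hQ : (Q 0).HasFreeParams) (i : ℕ) (v : V i) :
    nodeDegree (V 0) ((Q i).param v).2 = 1 := by
  induction i with
  | zero => simp [hQ _]
  | succ i ih =>
    rcases G.eq_incl_or_eq_sel v with ⟨u, rfl⟩ | ⟨a, rfl⟩
    · rw [(G.split i).param_old, ih]
    · rw [(G.split i).param_new, Prod.snd_add, map_add, ih, nodeDegree_single_none]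

theorem weightedSeries_eq (G : SplittingGrowth k l n (c, Finsupp.single none 1) Q)
    (hG : G.ShiftsZero) [∀ i, Fintype (V i)] [∀ i, DecidableEq (V i)]
    {W : ℕ → QSeries (Option (V 0))} (hW : IsSplitWeight k l c W) (m i : ℕ) :
    weightedSeries (Q i) (G.sel i) W m = weightedSeries (Q 0) (G.sel 0) W m := by
  induction i with
  | zero => rfl
  | succ i ih => rw [← ih, (G.split i).weightedSeries_eq (hG i) hW]

variable {W : Type*} {Qinf : SymQuiver W (Option (V 0))} {emb : ∀ i, V i ↪ W}
  {G : SplittingGrowth k l n (c, Finsupp.single none 1) Q}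

namespace IsUnion

theorem exists_emb_of_le (hU : G.IsUnion Qinf emb) {i j : ℕ} (hij : i ≤ j) (v : V i) :
    ∃ v', emb j v' = emb i v := by
  induction j, hij using Nat.le_induction with
  | base => exact ⟨v, rfl⟩
  | succ j _ ih =>
    obtain ⟨v', hv'⟩ := ih
    exact ⟨G.incl j v', by rw [hU.emb_incl, hv']⟩

theorem exists_emb_or_le (hU : G.IsUnion Qinf emb) (hQ : (Q 0).HasFreeParams) (j : ℕ) (w : W) :
    (∃ v, emb j v = w) ∨ j ≤ (Qinf.param w).2 none := by
  obtain ⟨i, v, rfl⟩ := hU.exhaust w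
  rcases le_total i j with hij | hij
  · exact Or.inl (hU.exists_emb_of_le hij v)
  · induction i, hij using Nat.le_induction with
    | base => exact Or.inl ⟨v, rfl⟩
    | succ i hij ih =>
      rcases G.eq_incl_or_eq_sel v with ⟨u, rfl⟩ | ⟨a, rfl⟩
      · rw [hU.emb_incl]
        exact ih u
      · right
        rw [hU.param, G.param_sel hQ]
        omega

theorem nodeDegree_param (hU : G.IsUnion Qinf emb) (hQ : (Q 0).HasFreeParams) (w : W) :
    nodeDegree (V 0) (Qinf.param w).2 = 1 := by
  obtain ⟨i, v, rfl⟩ := hU.exhaust w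
  rw [hU.param, G.nodeDegree_param hQ]

/-- A node outside `Q j` is created later and carries at least `x₀ ^ j`, so vectors with a smaller
power of `x₀` are supported on `Q j`. -/
theorem dimVectors_eq (hU : G.IsUnion Qinf emb) (hQ : (Q 0).HasFreeParams)
    {e : Option (V 0) →₀ ℕ} {j : ℕ} (hj : e none < j) :
    Qinf.dimVectors e = Finsupp.embDomain (emb j) '' (Q j).dimVectors e := by
  have hm := SymQuiver.monomial_embDomain (Q j) Qinf (emb j) (hU.param j)
  ext d
  constructor
  · intro hd
    have hd' : (Qinf.monomial d).2 = e := hd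
    have hs : (d.support : Set W) ⊆ Set.range (emb j) := by
      intro w hw
      refine (hU.exists_emb_or_le hQ j w).resolve_right fun hle => ?_
      have := Qinf.param_le_monomial (Finsupp.mem_support_iff.1 hw) none
      rw [hd'] at this
      omega
    refine ⟨Finsupp.comapDomain (emb j) d (emb j).injective.injOn, ?_,
      Finsupp.embDomain_comapDomain hs⟩
    change _ = _
    rw [← hm, Finsupp.embDomain_comapDomain hs, hd']
  · rintro ⟨d, hd, rfl⟩
    change _ = _
    rw [hm]
    exact hd

theorem isLocallyFinite (hU : G.IsUnion Qinf emb) (hQ : (Q 0).HasFreeParams) [Finite (V 0)] :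
    Qinf.IsLocallyFinite := by
  intro e
  have := G.finite (e none + 1)
  have := Fintype.ofFinite (V (e none + 1))
  rw [hU.dimVectors_eq hQ (Nat.lt_succ_self _),
    SymQuiver.dimVectors_eq _ (G.nodeDegree_param hQ _)]
  exact (Finset.finite_toSet _).image _

theorem coeff_motivicSeries (hU : G.IsUnion Qinf emb) (hQ : (Q 0).HasFreeParams)
    {e : Option (V 0) →₀ ℕ} {j : ℕ} (hj : e none < j) :
    MvPowerSeries.coeff e Qinf.motivicSeries = MvPowerSeries.coeff e (Q j).motivicSeries := by
  rw [SymQuiver.coeff_motivicSeries, SymQuiver.coeff_motivicSeries, hU.dimVectors_eq hQ hj,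
    finsum_mem_image (Finsupp.embDomain_injective (emb j)).injOn]
  simp only [SymQuiver.term_embDomain (Q j) Qinf (emb j) (hU.adj j) (hU.param j)]

/-- Every node of the union has a parameter of node degree `1`, so no nonzero dimension vector gives
a pure power of `x₀`. -/
theorem coeff_motivicSeries_single_none (hU : G.IsUnion Qinf emb) (hQ : (Q 0).HasFreeParams)
    (r : ℕ) (hr : r ≠ 0) :
    MvPowerSeries.coeff (Finsupp.single none r) Qinf.motivicSeries = 0 := by
  have h : Qinf.dimVectors (Finsupp.single none r) = ∅ := by
    refine Set.eq_empty_of_forall_notMem fun d hd => hr ?_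
    have hd' : (Qinf.monomial d).2 = Finsupp.single none r := hd
    have h1 := Qinf.nodeDegree_monomial (hU.nodeDegree_param hQ) d
    rw [hd', nodeDegree_single_none] at h1
    obtain rfl : d = 0 := (Finsupp.degree_eq_zero_iff _).1 h1.symm
    have h2 : (0 : Option (V 0) →₀ ℕ) = Finsupp.single none r := by
      rw [← hd']; simp [SymQuiver.monomial]
    simpa using h2.symm
  rw [SymQuiver.coeff_motivicSeries, h, finsum_mem_empty]

theorem constantCoeff_motivicSeries (hU : G.IsUnion Qinf emb) (hQ : (Q 0).HasFreeParams) :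
    MvPowerSeries.constantCoeff Qinf.motivicSeries = 1 := by
  have h : Qinf.dimVectors 0 = {0} := by
    ext d
    constructor
    · intro hd
      have hd' : (Qinf.monomial d).2 = 0 := hd
      have h1 := Qinf.nodeDegree_monomial (hU.nodeDegree_param hQ) d
      rw [hd', map_zero] at h1
      exact (Finsupp.degree_eq_zero_iff _).1 h1.symm
    · rintro rfl
      simp [SymQuiver.dimVectors, SymQuiver.monomial]
  rw [← MvPowerSeries.coeff_zero_eq_constantCoeff_apply, SymQuiver.coeff_motivicSeries, h,
    finsum_mem_singleton]
  simp [SymQuiver.term, SymQuiver.quadForm, SymQuiver.monomial, negQPow_zero, qPow_zero]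

/-- The generating series of the union, times the one of the extra node, is the generating series of
the augmented quiver. -/
theorem motivicSeries_mul (hU : G.IsUnion Qinf emb) (hQ : (Q 0).HasFreeParams) [Finite (V 0)]
    (hG : G.ShiftsZero) {wt : ℕ → QSeries (Option (V 0))} (hW : IsSplitWeight k l c wt)
    (hW0 : wt 0 = 1) {m z : ℤ}
    (hwt : ∀ N : ℕ, wt N * extraSeries (V 0) m 0 = extraSeries (V 0) m (z * N)) :
    Qinf.motivicSeries * extraSeries (V 0) m 0 = ((Q 0).augment (G.sel 0) m z).motivicSeries := by
  classical
  have := G.finite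
  have := fun i => Fintype.ofFinite (V i)
  ext1 e
  -- The extra series contains only powers of `x₀`, so the cofactor keeps the node degree of `e`.
  -- Its coefficient is computed in a `Q j` with `j` above its exponent of `x₀` and carried back to
  -- `Q 0` by invariance.
  have h1 : MvPowerSeries.coeff e (Qinf.motivicSeries * extraSeries (V 0) m 0) =
      MvPowerSeries.coeff e (weightedSeries (Q 0) (G.sel 0) wt (nodeDegree (V 0) e) *
        extraSeries (V 0) m 0) := by
    rw [MvPowerSeries.coeff_mul, MvPowerSeries.coeff_mul]
    refine Finset.sum_congr rfl fun p hp => ?_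
    rw [Finset.HasAntidiagonal.mem_antidiagonal] at hp
    rw [coeff_extraSeries]
    split_ifs with h2
    · have h3 : nodeDegree (V 0) e = nodeDegree (V 0) p.1 := by
        rw [← hp, map_add, ← h2, nodeDegree_single_none, add_zero]
      have h4 : p.1 none < p.1 none + 1 := Nat.lt_succ_self _
      rw [h3, ← G.weightedSeries_eq hG hW _ (p.1 none + 1),
        SymQuiver.coeff_weightedSeries _ (G.nodeDegree_param hQ _) _ hW0
          (fun a => by rw [G.param_sel hQ]; exact h4), hU.coeff_motivicSeries hQ h4]
    · rw [mul_zero, mul_zero]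
  have hmon := SymQuiver.monomial_of_param (Q 0) Function.Embedding.some hQ
  have hemb : ∀ d : V 0 →₀ ℕ, ∀ v, d.embDomain Function.Embedding.some (some v) = d v :=
    fun d v => Finsupp.embDomain_apply_self _ _ _
  have hnone : ∀ d : V 0 →₀ ℕ, d.embDomain Function.Embedding.some none = 0 :=
    fun d => Finsupp.embDomain_of_notMem_range _ _ _ (by simp)
  have h2 := SymQuiver.coeff_motivicSeries_embDomain _ _
    ((Q 0).augment_param hQ (G.sel 0) m z) e
  rw [Finsupp.embDomain_refl, id_eq] at h2
  have hle : e.some.embDomain Function.Embedding.some ≤ e := by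
    intro i
    cases i with
    | none => rw [hnone]; exact Nat.zero_le _
    | some v => rw [hemb]; rfl
  have hsub : e - e.some.embDomain Function.Embedding.some = Finsupp.single none (e none) := by
    ext i
    cases i with
    | none => simp [hnone]
    | some v => simp [hemb]
  -- The extra series changes only the exponent of `x₀`, so `d` must agree with `e` at all the other
  -- variables.
  rw [h1, h2, SymQuiver.term_augment _ hQ, weightedSeries, Finset.sum_mul, map_sum,
    Finset.sum_eq_single e.some]
  · rw [mul_assoc, hwt, hmon, MvPowerSeries.coeff_monomial_mul, if_pos hle, hsub, coeff_extraSeries]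
    simp
  · intro d _ hd
    rw [mul_assoc, hwt, hmon, MvPowerSeries.coeff_monomial_mul]
    split_ifs with hde
    · rw [coeff_extraSeries, if_neg, mul_zero]
      intro h3
      refine hd ?_
      ext v
      have h4 := DFunLike.congr_fun h3 (some v)
      have h5 := hde (some v)
      simp only [hemb, Finsupp.tsub_apply] at h4 h5
      rw [Finsupp.single_eq_of_ne (by simp)] at h4
      rw [Finsupp.some_apply]
      omega
    · rfl
  · intro h3
    refine absurd ?_ h3
    rw [Finset.mem_finsuppAntidiag]
    exact ⟨by rw [nodeDegree_apply, Finsupp.degree_eq_sum], Finset.subset_univ _⟩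

theorem spectrumEqMinusExtraNode (hU : G.IsUnion Qinf emb) (hQ : (Q 0).HasFreeParams)
    [Finite (V 0)] (hG : G.ShiftsZero) {wt : ℕ → QSeries (Option (V 0))}
    (hW : IsSplitWeight k l c wt) (hW0 : wt 0 = 1) {m z s ω : ℤ}
    (hwt : ∀ N : ℕ, wt N * extraSeries (V 0) m 0 = extraSeries (V 0) m (z * N))
    (hs : HasDilogProd (singleState (V 0) s ω) (extraSeries (V 0) m 0)) :
    SpectrumEqMinusExtraNode Qinf ((Q 0).augment (G.sel 0) m z) s ω := by
  have hmul := hU.motivicSeries_mul hQ hG hW hW0 hwt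
  obtain ⟨Ω, hΩ, hΩu⟩ := existsUnique_isDTInvariants (hU.isLocallyFinite hQ)
    (hU.constantCoeff_motivicSeries hQ)
  have hplus : IsDTInvariants ((Q 0).augment (G.sel 0) m z) (Ω + singleState (V 0) s ω) := by
    refine ⟨SymQuiver.isLocallyFinite_of_param _ _ ((Q 0).augment_param hQ (G.sel 0) m z), ?_⟩
    rw [← hmul]
    exact HasDilogProd.add hΩ.2 hs
  obtain ⟨hf, hser⟩ := SymQuiver.motivicSeries_extraNode (Q 0) (G.sel 0) m z
    (⟨fun _ => none, fun _ _ _ => rfl⟩ : Unit ↪ Option (V 0)) fun _ => rfl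
  have hextra : IsDTInvariants (((Q 0).augment (G.sel 0) m z).subquiver
      (⟨fun _ => none, fun _ _ _ => rfl⟩ : Unit ↪ Option (V 0))) (singleState (V 0) s ω) := by
    refine ⟨hf, ?_⟩
    rw [hser]
    exact hs
  refine ⟨⟨Ω, hΩ, hΩu⟩, ⟨_, hplus, fun Ω' h' => HasDilogProd.spectrum_unique h'.2 hplus.2⟩,
    ⟨_, hextra, fun Ω' h' => HasDilogProd.spectrum_unique h'.2 hextra.2⟩, hextra, ?_⟩
  intro Ωinf Ωplus hinf hpl
  obtain rfl := hΩu Ωinf hinf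
  obtain rfl := HasDilogProd.spectrum_unique hpl.2 hplus.2
  refine ⟨?_, fun d => by simp⟩
  -- The exponent of `x₀` has degree `1`, so there are no nonzero exponents of lower degree and the
  -- invariant is read off from one coefficient.
  have h1 := HasDilogProd.coeff_eq hinf.2 (extraDim (V 0)) fun d hd => by
    simp only [extraDim, Finsupp.degree_single] at hd
    exact absurd ((Finsupp.degree_eq_zero_iff _).1 (by omega)) d.2
  rw [h1, extraDim, hU.coeff_motivicSeries_single_none hQ 1 one_ne_zero, mul_zero, neg_zero]

end IsUnion

end SplittingGrowth

theorem theorem3p7 {V : ℕ → Type*} [Finite (V 0)] {W : Type*} (n : ℕ)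
    (Q : ∀ i, SymQuiver (V i) (Option (V 0))) (hQ : (Q 0).HasFreeParams)
    (Qinf : SymQuiver W (Option (V 0))) (emb : ∀ i, V i ↪ W) :
    (∀ G : SplittingGrowth 0 2 n (-1, Finsupp.single none 1) Q,
      G.ShiftsZero → G.IsUnion Qinf emb →
        SpectrumEqMinusExtraNode Qinf ((Q 0).augment (G.sel 0) 1 1) 1 1) ∧
    (∀ G : SplittingGrowth (-1) (-2) n (0, Finsupp.single none 1) Q,
      G.ShiftsZero → G.IsUnion Qinf emb →
        SpectrumEqMinusExtraNode Qinf ((Q 0).augment (G.sel 0) 0 (-1)) 0 (-1)) := by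
  refine ⟨fun G hG hU => ?_, fun G hG hU => ?_⟩
  · exact hU.spectrumEqMinusExtraNode hQ hG isSplitWeight_unlinkWeight (by simp [unlinkWeight])
      unlinkWeight_mul_extraSeries (hasDilogProd_singleState zero_le_one extraSeries_one)
  · exact hU.spectrumEqMinusExtraNode hQ hG isSplitWeight_linkWeight (by simp [linkWeight])
      linkWeight_mul_extraSeries (hasDilogProd_singleState le_rfl extraSeries_zero)
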